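/- All objects are smooth. Let $M$ be an $n$-dimensional (Hausdorff, second countable) manifold with a Poisson bivector field $w$, with $\{f,g\}_w=w(df,dg)$ and $\beta(\alpha^\sharp)=w(\alpha,\beta)$, and let $\pi:T^*M\to M$ be its cotangent bundle. Let $\chi(M)$ be the space of vector fields on $M$ and $S_2(TM)$ the space of symmetric $2$-contravariant tensor fields on $M$. For $X,Y\in\chi(M)$ and $Q\in S_2(TM)$ let $m(X)(x,\alpha)=\alpha(X_x)$ and $s(Q)(x,\alpha)=Q_x(\alpha,\alpha)$ be the corresponding functions on $T^*M$, and let $X\odot Y=\frac12(X\otimes Y+Y\otimes X)$. A bivector field $W$ on $T^*M$, with bracket $\{F,G\}_W=W(dF,dG)$, is *graded* if in the local coordinates $(x^i,p_i)$ of $T^*M$ induced by local coordinates of $M$ it has the form $$W=\tfrac12 w^{ij}(x)\,\partial_{x^i}\wedge\partial_{x^j}+p_aA^{ia}_j(x)\,\partial_{x^i}\wedge\partial_{p_j}+\tfrac12 p_ap_bC^{ab}_{ij}(x)\,\partial_{p_i}\wedge\partial_{p_j}.$$ It is *semi-Poisson* if $\{\,,\}_W$ is a Lie algebra bracket on the functions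 that are constant on the fibres of $\pi$. A *lift* of $w$ is a graded semi-Poisson bivector field on $T^*M$ that is $\pi$-related with $w$. A *contravariant connection* of $(M,w)$ is an operator $D:\Omega^1(M)\times\chi(M)\to\chi(M)$ that is $C^\infty(M)$-linear in the $1$-form, additive in the vector field, and satisfies $D_\alpha(fX)=fD_\alpha X+(\alpha^\sharp f)X$. **Proposition.** (i) For every lift $W$ of $w$ there are a unique contravariant connection $D$ and a unique operator $\Psi:\chi(M)\times\chi(M)\to S_2(TM)$ such that for all $f,g\in C^\infty(M)$ and $X,Y\in\chi(M)$ $$\{f,g\}_W=\{f,g\}_w,\qquad \{m(X),f\}_W=-m(D_{df}X),\qquad \{m(X),m(Y)\}_W=s(\Psi(X,Y)).\tag{1}$$ (ii) Fix a lift $W_0$ of $w$, with connection $D_0$ and operator $\Psi_0$. For a $(2,1)$-tensor field $\tau$, i.e. a $C^\infty(M)$-bilinear map $\Omega^1(M)\times\chi(M)\to\chi(M)$, call an operator $A:\chi(M)\times\chi(M)\to S_2(TM)$ *$\tau$-admissible* if it is a skew-symmetric bidifferential operator of the first order (order at most one in each argument) and $$A(X,fY)=fA(X,Y)-\tau(df,X)\odot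 Y\qquad (f\in C^\infty(M),\ X,Y\in\chi(M)).\tag{2}$$ Then: (a) Every contravariant connection $D$ can be written as $D=D_0+\tau$ with a $(2,1)$-tensor field $\tau$, and there exists a $\tau$-admissible operator $A$. (b) If $W$ is a lift of $w$ with connection $D=D_0+\tau$ and operator $\Psi$, and $A$ is any $\tau$-admissible operator, then $$\Psi=\Psi_0+A+T\tag{3}$$ for a unique $(2,2)$-tensor field $T$ (a $C^\infty(M)$-bilinear map $\chi(M)\times\chi(M)\to S_2(TM)$) with $T(Y,X)=-T(X,Y)$. (c) Conversely, for every contravariant connection $D=D_0+\tau$, every $\tau$-admissible operator $A$ and every skew-symmetric $(2,2)$-tensor field $T$ with values in $S_2(TM)$, there is a lift $W$ of $w$ that satisfies (1) with this $D$ and with $\Psi=\Psi_0+A+T$, and it is the only bivector field on $T^*M$ that satisfies these relations. -/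

import Mathlib

open Bundle Manifold
open scoped ContDiff Topology

noncomputable section

namespace CotangentLift

section General

variable {E : Type*} [NormedAddCommGroup E] [NormedSpace ℝ E]
  {H : Type*} [TopologicalSpace H] (I : ModelWithCorners ℝ E H)
  (M : Type*) [TopologicalSpace M] [ChartedSpace H M]

section SectionModule

variable {I M} {F : Type*} [NormedAddCommGroup F] [NormedSpace ℝ F]
  {V : M → Type*} [TopologicalSpace (TotalSpace F V)] [∀ x, TopologicalSpace (V x)]
  [FiberBundle F V] [∀ x, AddCommGroup (V x)] [∀ x, Module ℝ (V x)] [VectorBundle ℝ F V]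

/-- Pointwise multiplication of smooth sections of a vector bundle by smooth functions. -/
instance sectionSMul : SMul C^∞⟮I, M; ℝ⟯ Cₛ^∞⟮I; F, V⟯ where
  smul f s := ⟨fun x => f x • s x, f.contMDiff.smul_section s.contMDiff⟩

/-- Smooth sections of a vector bundle form a module over the ring of smooth functions. -/
instance sectionModule : Module C^∞⟮I, M; ℝ⟯ Cₛ^∞⟮I; F, V⟯ where
  one_smul s := by ext x; exact one_smul ℝ (s x)
  mul_smul f g s := by ext x; exact mul_smul (f x) (g x) (s x)
  smul_zero f := by ext x; exact smul_zero (f x)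
  smul_add f s t := by ext x; exact smul_add (f x) (s x) (t x)
  add_smul f g s := by ext x; exact add_smul (f x) (g x) (s x)
  zero_smul s := by ext x; exact zero_smul ℝ (s x)

end SectionModule

variable [IsManifold I ∞ M]

/-- The module of smooth vector fields on `M`. -/
abbrev VectorField := Cₛ^∞⟮I; E, (fun x : M => TangentSpace I x)⟯

/-- The module of smooth `1`-forms (Pfaff forms) on `M`. -/
abbrev OneForm := Cₛ^∞⟮I; E →L[ℝ] ℝ, (fun x : M => TangentSpace I x →L[ℝ] ℝ)⟯

/-- The module of smooth `2`-contravariant tensor fields on a finite-dimensional manifold `M`.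
Such a tensor field `Q` is given by the bundle map `α ↦ α^♯ : T*M → TM` for which
`Q(α, β) = β(α^♯)`, i.e. by a smooth section of `Hom(T*M, TM) = TM ⊗ TM`. -/
abbrev ContraTwo := Cₛ^∞⟮I; (E →L[ℝ] ℝ) →L[ℝ] E,
  (fun x : M => (TangentSpace I x →L[ℝ] ℝ) →L[ℝ] TangentSpace I x)⟯

instance contraTwoAddCommGroup : AddCommGroup (ContraTwo I M) := ContMDiffSection.instAddCommGroup

instance contraTwoModule : Module C^∞⟮I, M; ℝ⟯ (ContraTwo I M) := sectionModule

variable {I M}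

/-- The value `Q(α, β)` of a `2`-contravariant tensor field on two covectors at `x`. -/
def ContraTwo.val (Q : ContraTwo I M) (x : M) (α β : TangentSpace I x →L[ℝ] ℝ) : ℝ :=
  β (Q x α)

variable (I M)

/-- The space `S₂(TM)` of symmetric `2`-contravariant tensor fields, a submodule over `C^∞(M)`. -/
def SymTwo : Submodule C^∞⟮I, M; ℝ⟯ (ContraTwo I M) where
  carrier := {Q | ∀ (x : M) (α β : TangentSpace I x →L[ℝ] ℝ), Q.val x α β = Q.val x β α}
  add_mem' := by
    intro P Q hP hQ x α β
    have h : ∀ α β : TangentSpace I x →L[ℝ] ℝ,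
        (P + Q).val x α β = P.val x α β + Q.val x α β :=
      fun α β => β.map_add (P x α) (Q x α)
    rw [h, h, hP, hQ]
  zero_mem' := by
    intro x α β
    have h : ∀ α β : TangentSpace I x →L[ℝ] ℝ, (0 : ContraTwo I M).val x α β = 0 :=
      fun α β => β.map_zero
    rw [h, h]
  smul_mem' := by
    intro f Q hQ x α β
    have h : ∀ α β : TangentSpace I x →L[ℝ] ℝ, (f • Q).val x α β = f x * Q.val x α β :=
      fun α β => β.map_smul (f x) (Q x α)
    rw [h, h, hQ]

instance symTwoAddCommGroup : AddCommGroup (SymTwo I M) := (SymTwo I M).addCommGroup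

instance symTwoModule : Module C^∞⟮I, M; ℝ⟯ (SymTwo I M) := (SymTwo I M).module

instance symTwoNeg : Neg (SymTwo I M) := (symTwoAddCommGroup I M).toNeg

instance symTwoSub : Sub (SymTwo I M) := (symTwoAddCommGroup I M).toSub

instance symTwoAdd : Add (SymTwo I M) := (symTwoAddCommGroup I M).toAdd

instance symTwoSMul : SMul C^∞⟮I, M; ℝ⟯ (SymTwo I M) := (symTwoModule I M).toSMul

/-- A smooth bivector field on `M`: a skew-symmetric `2`-contravariant tensor field. -/
structure BivectorField where
  /-- the underlying `2`-contravariant tensor field -/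
  tensor : ContraTwo I M
  skew : ∀ (x : M) (α β : TangentSpace I x →L[ℝ] ℝ), tensor.val x α β = -tensor.val x β α

variable {I M}

/-- The bracket `{F, G} = W(dF, dG)` of two functions. -/
def BivectorField.bracket (W : BivectorField I M) (F G : M → ℝ) : M → ℝ :=
  fun x => W.tensor.val x (mvfderiv I F x) (mvfderiv I G x)

/-- A bivector field is Poisson if its bracket satisfies the Jacobi identity on smooth functions
(bilinearity, skew-symmetry and the Leibniz rule are automatic). -/
def BivectorField.IsPoisson (w : BivectorField I M) : Prop :=
  ∀ f g h : C^∞⟮I, M; ℝ⟯,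
    w.bracket f (w.bracket g h) + w.bracket g (w.bracket h f) + w.bracket h (w.bracket f g) = 0

/-- The smooth function `w(α, β) = β(α^♯)` for two `1`-forms. For `α = df` and `β = dg` it is the
bracket of `f` and `g`, and for `β = dg` it is the derivative `α^♯ g`. -/
def BivectorField.pair (w : BivectorField I M) (α β : OneForm I M) : C^∞⟮I, M; ℝ⟯ :=
  ⟨fun x => w.tensor.val x (α x) (β x), by
    intro x
    have h1 := ContMDiffAt.clm_bundle_apply (w.tensor.contMDiff x) (α.contMDiff x)
    have h2 := ContMDiffAt.clm_bundle_apply (E₂ := Bundle.Trivial M ℝ) (F₂ := ℝ)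
      (β.contMDiff x) h1
    rw [contMDiffAt_section] at h2
    exact h2⟩

/-- The differential `df` of a smooth function. -/
def differential (f : C^∞⟮I, M; ℝ⟯) : OneForm I M :=
  ⟨fun x => mvfderiv I f x, by
    intro x
    have h := ContMDiffAt.mfderiv_const (f.contMDiff x) (m := ∞) (by simp)
    rw [contMDiffAt_hom_bundle]
    refine ⟨contMDiffAt_id, ?_⟩
    convert h using 2 with y
    ext v
    simp [inTangentCoordinates, ContinuousLinearMap.inCoordinates, mvfderiv]
    rfl⟩

/-- The tensor product `v ⊗ w` of two vectors, as the map `α ↦ α(v) w` on covectors. -/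
def tensorVec {V : Type*} [AddCommGroup V] [Module ℝ V] [TopologicalSpace V]
    [IsTopologicalAddGroup V] [ContinuousSMul ℝ V] (v w : V) : (V →L[ℝ] ℝ) →L[ℝ] V where
  toFun α := α v • w
  map_add' α β := by simp [add_smul]
  map_smul' c α := by simp [mul_smul]
  cont := (continuous_eval_const v).smul continuous_const

set_option synthInstance.maxHeartbeats 200000 in
theorem contMDiff_tensorVec (X Y : VectorField I M) :
    ContMDiff I (I.prod 𝓘(ℝ, (E →L[ℝ] ℝ) →L[ℝ] E)) ∞
      (fun x : M => TotalSpace.mk' ((E →L[ℝ] ℝ) →L[ℝ] E)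
        (E := (fun x : M => (TangentSpace I x →L[ℝ] ℝ) →L[ℝ] TangentSpace I x)) x
        (tensorVec (X x) (Y x))) := by
  intro x₀
  rw [contMDiffAt_hom_bundle]
  refine ⟨contMDiffAt_id, ?_⟩
  have hX := (contMDiffAt_section x₀).1 (X.contMDiff x₀)
  have hY := (contMDiffAt_section x₀).1 (Y.contMDiff x₀)
  set e := trivializationAt E (TangentSpace I) x₀ with he
  have hS : ContDiff ℝ ∞ (fun p : E × E =>
      (ContinuousLinearMap.apply ℝ ℝ p.1).smulRight p.2) := by
    have h1 : ContDiff ℝ ∞ (fun v : E => ContinuousLinearMap.apply ℝ ℝ v) :=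
      ContinuousLinearMap.contDiff (𝕜 := ℝ) (F := (E →L[ℝ] ℝ) →L[ℝ] ℝ) (ContinuousLinearMap.apply ℝ ℝ)
    exact (h1.comp contDiff_fst).smulRight contDiff_snd
  have hB : ContMDiffAt I 𝓘(ℝ, (E →L[ℝ] ℝ) →L[ℝ] E) ∞
      (fun x => (ContinuousLinearMap.apply ℝ ℝ (e ⟨x, X x⟩).2).smulRight (e ⟨x, Y x⟩).2) x₀ :=
    hS.contMDiff.contMDiffAt.comp x₀ (hX.prodMk_space hY)
  refine hB.congr_of_eventuallyEq ?_
  filter_upwards [e.open_baseSet.mem_nhds (FiberBundle.mem_baseSet_trivializationAt' x₀)] with x hx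
  ext a
  have hx' : x ∈ (trivializationAt (E →L[ℝ] ℝ) (fun b : M => TangentSpace I b →L[ℝ] ℝ) x₀).baseSet := by
    rw [hom_trivializationAt_baseSet]
    exact ⟨hx, trivial⟩
  have h1 := ContinuousLinearMap.inCoordinates_eq (ϕ := tensorVec (X x) (Y x)) hx' hx
  have h2 : (trivializationAt (E →L[ℝ] ℝ) (fun b : M => TangentSpace I b →L[ℝ] ℝ) x₀).symm x a (X x)
    = a (e ⟨x, X x⟩).2 := by
    have h3 := congrArg Prod.snd (Trivialization.apply_mk_symm
      (trivializationAt (E →L[ℝ] ℝ) (fun b : M => TangentSpace I b →L[ℝ] ℝ) x₀) hx' a)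
    rw [hom_trivializationAt_apply] at h3
    simp only at h3
    rw [ContinuousLinearMap.inCoordinates_eq hx (by trivial)] at h3
    conv_rhs => rw [← h3]
    simp [e, Trivialization.symm_apply_apply_mk _ hx]
  refine (congrArg (fun L => L a) h1).trans ?_
  simp [tensorVec, h2, e]

/-- The tensor product `X ⊗ Y` of two vector fields. -/
def tensorProd (X Y : VectorField I M) : ContraTwo I M :=
  ⟨fun x => tensorVec (X x) (Y x), contMDiff_tensorVec X Y⟩

/-- The symmetric product `X ⊙ Y = (X ⊗ Y + Y ⊗ X) / 2` of two vector fields. -/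
def symProd (X Y : VectorField I M) : SymTwo I M :=
  ⟨(1 / 2 : ℝ) • (tensorProd X Y + tensorProd Y X), by
    intro x α β
    have h : ∀ α β : TangentSpace I x →L[ℝ] ℝ,
        ContraTwo.val ((1 / 2 : ℝ) • (tensorProd X Y + tensorProd Y X)) x α β
          = (1 / 2 : ℝ) * (α (X x) * β (Y x) + α (Y x) * β (X x)) := by
      intro α β
      change β ((1 / 2 : ℝ) • (α (X x) • Y x + α (Y x) • X x)) = _
      simp only [map_smul, map_add, smul_eq_mul]
    rw [h, h]
    ring⟩

/-- A contravariant connection (contravariant derivative on `TM`) of `(M, w)`: an operator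
`D : Ω¹(M) × χ(M) → χ(M)` which is `C^∞(M)`-linear in the first argument, additive in the second
one, and satisfies `D_α(fX) = f D_α X + (α^♯ f) X`, where `α^♯ f = w(α, df)`. -/
structure ContravariantConnection (w : BivectorField I M) where
  /-- the operator `(α, X) ↦ D_α X` -/
  toFun : OneForm I M → VectorField I M → VectorField I M
  add_left : ∀ α β X, toFun (α + β) X = toFun α X + toFun β X
  smul_left : ∀ (f : C^∞⟮I, M; ℝ⟯) α X, toFun (f • α) X = f • toFun α X
  add_right : ∀ α X Y, toFun α (X + Y) = toFun α X + toFun α Y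
  leibniz : ∀ α (f : C^∞⟮I, M; ℝ⟯) X,
    toFun α (f • X) = f • toFun α X + w.pair α (differential f) • X

variable (I M)

/-- A `(2,1)`-tensor field `τ`, as a `C^∞(M)`-bilinear map `(α, X) ↦ τ(α, X)` from a `1`-form and
a vector field to a vector field. -/
abbrev TensorTwoOne :=
  OneForm I M →ₗ[C^∞⟮I, M; ℝ⟯] VectorField I M →ₗ[C^∞⟮I, M; ℝ⟯] VectorField I M

/-- A `(2,2)`-tensor field `T` on `M` with `T(X, Y) ∈ S₂(TM)`, as a `C^∞(M)`-bilinear map. -/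
abbrev SymTensorTwoTwo :=
  VectorField I M →ₗ[C^∞⟮I, M; ℝ⟯] VectorField I M →ₗ[C^∞⟮I, M; ℝ⟯] SymTwo I M

variable {I M}

/-- `B : χ(M) × χ(M) → S₂(TM)` is a bidifferential operator of the first order: it is
`ℝ`-bilinear and, in each argument separately, a differential operator of order at most one, that
is, its double commutator with multiplication by any two smooth functions vanishes. -/
structure IsFirstOrderBidifferential
    (B : VectorField I M → VectorField I M → SymTwo I M) : Prop where
  add_left : ∀ X X' Y, B (X + X') Y = B X Y + B X' Y
  add_right : ∀ X Y Y', B X (Y + Y') = B X Y + B X Y'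
  const_smul_left : ∀ (c : ℝ) X Y, (B (c • X) Y : ContraTwo I M) = c • (B X Y : ContraTwo I M)
  const_smul_right : ∀ (c : ℝ) X Y, (B X (c • Y) : ContraTwo I M) = c • (B X Y : ContraTwo I M)
  order_left : ∀ (f g : C^∞⟮I, M; ℝ⟯) X Y,
    B (f • g • X) Y - f • B (g • X) Y - g • B (f • X) Y + f • g • B X Y = 0
  order_right : ∀ (f g : C^∞⟮I, M; ℝ⟯) X Y,
    B X (f • g • Y) - f • B X (g • Y) - g • B X (f • Y) + f • g • B X Y = 0

/-- `A` is a skew-symmetric bidifferential operator of the first order such that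
`A(X, fY) = f A(X, Y) - τ(df, X) ⊙ Y`. -/
structure IsSkewOperatorWithSymbol (τ : TensorTwoOne I M)
    (A : VectorField I M → VectorField I M → SymTwo I M) : Prop where
  bidifferential : IsFirstOrderBidifferential A
  skew : ∀ X Y, A Y X = -A X Y
  symbol : ∀ X (f : C^∞⟮I, M; ℝ⟯) Y,
    A X (f • Y) = f • A X Y - symProd (τ (differential f) X) Y

end General

section Cotangent

variable (n : ℕ) (M : Type*) [TopologicalSpace M] [ChartedSpace (EuclideanSpace ℝ (Fin n)) M]
  [IsManifold (𝓡 n) ∞ M]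

/-- The cotangent bundle `T*M` of an `n`-dimensional manifold `M`; a point is a pair `⟨x, α⟩` with
`α` a covector at `x`. -/
abbrev CotangentBundle :=
  TotalSpace (EuclideanSpace ℝ (Fin n) →L[ℝ] ℝ) (fun x : M => TangentSpace (𝓡 n) x →L[ℝ] ℝ)

/-- The model with corners of the manifold `T*M`. -/
abbrev cotangentModel :=
  (𝓡 n).prod 𝓘(ℝ, EuclideanSpace ℝ (Fin n) →L[ℝ] ℝ)

variable {n M}

/-- The projection `π : T*M → M`. -/
def proj (z : CotangentBundle n M) : M := z.1

/-- The momentum `m(X)` of a vector field: `m(X)(x, α) = α(X_x)`. -/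
def momentum (X : VectorField (𝓡 n) M) : CotangentBundle n M → ℝ :=
  fun z => z.2 (X z.1)

/-- The quadratic polynomial `s(Q)` of a symmetric tensor field: `s(Q)(x, α) = Q_x(α, α)`. -/
def quadratic (Q : SymTwo (𝓡 n) M) : CotangentBundle n M → ℝ :=
  fun z => (Q : ContraTwo (𝓡 n) M).val z.1 z.2 z.2

/-- The coordinate vector field `∂/∂xⁱ` of the chart at `x₀`, at a point `y` of its domain. -/
def coordVector (x₀ y : M) (i : Fin n) : TangentSpace (𝓡 n) y :=
  mfderiv 𝓘(ℝ, EuclideanSpace ℝ (Fin n)) (𝓡 n) (extChartAt (𝓡 n) x₀).symm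
    (extChartAt (𝓡 n) x₀ y) (EuclideanSpace.single i (1 : ℝ))

/-- The coordinate function `xⁱ` (pulled back to `T*M`) of the chart of `M` at `x₀`. -/
def coordX (x₀ : M) (i : Fin n) : CotangentBundle n M → ℝ :=
  fun z => (extChartAt (𝓡 n) x₀ z.1 : EuclideanSpace ℝ (Fin n)) i

/-- The covector coordinate function `p_i` with respect to the cobasis `dxⁱ` of the chart at
`x₀`. -/
def coordP (x₀ : M) (i : Fin n) : CotangentBundle n M → ℝ :=
  fun z => z.2 (coordVector x₀ z.1 i)

variable (n M) in
/-- Smooth bivector fields on the manifold `T*M`. -/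
abbrev CotangentBivector := BivectorField (cotangentModel n) (CotangentBundle n M)

/-- `W` is a graded bivector field on `T*M`: around every point of `M` it has the local form
`½ w^{ij}(x) ∂/∂xⁱ ∧ ∂/∂xʲ + p_a A^{ia}_j(x) ∂/∂xⁱ ∧ ∂/∂p_j + ½ p_a p_b C^{ab}_{ij}(x) ∂/∂p_i ∧ ∂/∂p_j`
with smooth local coefficients on `M`. Since `(dxⁱ, dp_i)` is a local coframe, this is said by
prescribing the values of `W` on the pairs of these differentials. -/
def IsGraded (W : CotangentBivector n M) : Prop :=
  ∀ x₀ : M, ∃ (c : Fin n → Fin n → M → ℝ) (A : Fin n → Fin n → Fin n → M → ℝ)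
    (C : Fin n → Fin n → Fin n → Fin n → M → ℝ),
    (∀ i j, ContMDiffOn (𝓡 n) 𝓘(ℝ) ∞ (c i j) (extChartAt (𝓡 n) x₀).source) ∧
    (∀ i a j, ContMDiffOn (𝓡 n) 𝓘(ℝ) ∞ (A i a j) (extChartAt (𝓡 n) x₀).source) ∧
    (∀ a b i j, ContMDiffOn (𝓡 n) 𝓘(ℝ) ∞ (C a b i j) (extChartAt (𝓡 n) x₀).source) ∧
    ∀ z : CotangentBundle n M, proj z ∈ (extChartAt (𝓡 n) x₀).source →
      ∀ i j : Fin n,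
        W.bracket (coordX x₀ i) (coordX x₀ j) z = c i j (proj z) ∧
        W.bracket (coordX x₀ i) (coordP x₀ j) z = ∑ a, coordP x₀ a z * A i a j (proj z) ∧
        W.bracket (coordP x₀ i) (coordP x₀ j) z =
          ∑ a, ∑ b, coordP x₀ a z * coordP x₀ b z * C a b i j (proj z)

/-- A function on `T*M` is foliated for the vertical foliation if it is constant on the fibres. -/
def IsFoliated (F : CotangentBundle n M → ℝ) : Prop :=
  ∀ z z' : CotangentBundle n M, proj z = proj z' → F z = F z'

/-- `W` is a semi-Poisson structure on `T*M`, i.e. a transversal Poisson structure of the vertical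
foliation: its bracket is a Lie algebra bracket on the smooth foliated functions (bilinearity and
skew-symmetry are automatic). -/
def IsSemiPoisson (W : CotangentBivector n M) : Prop :=
  (∀ F G : C^∞⟮cotangentModel n, CotangentBundle n M; ℝ⟯, IsFoliated F → IsFoliated G →
    IsFoliated (W.bracket F G)) ∧
  ∀ F G K : C^∞⟮cotangentModel n, CotangentBundle n M; ℝ⟯,
    IsFoliated F → IsFoliated G → IsFoliated K →
    W.bracket F (W.bracket G K) + W.bracket G (W.bracket K F) + W.bracket K (W.bracket F G) = 0

/-- `W` is `π`-related with `w`: `W_z(π^*α, π^*β) = w_{π(z)}(α, β)` for all covectors `α`, `β` at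
`π(z)`. -/
def IsProjRelated (W : CotangentBivector n M) (w : BivectorField (𝓡 n) M) : Prop :=
  ∀ (z : CotangentBundle n M) (α β : TangentSpace (𝓡 n) (proj z) →L[ℝ] ℝ),
    W.tensor.val z (α.comp (mfderiv (cotangentModel n) (𝓡 n) proj z))
      (β.comp (mfderiv (cotangentModel n) (𝓡 n) proj z)) = w.tensor.val (proj z) α β

/-- `W` is a graded semi-Poisson structure on `T*M` which is `π`-related with `w`. -/
structure IsGradedSemiPoissonLift (w : BivectorField (𝓡 n) M) (W : CotangentBivector n M) :
    Prop where
  graded : IsGraded W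
  semiPoisson : IsSemiPoisson W
  related : IsProjRelated W w

/-- The bracket of `W` is given by `w`, the contravariant connection `D` and the operator `Ψ`:
`{f, g}_W = {f, g}_w`, `{m(X), f}_W = -m(D_{df} X)` and `{m(X), m(Y)}_W = s(Ψ(X, Y))`. -/
structure IsDefinedBy {w : BivectorField (𝓡 n) M} (W : CotangentBivector n M)
    (D : ContravariantConnection w)
    (Ψ : VectorField (𝓡 n) M → VectorField (𝓡 n) M → SymTwo (𝓡 n) M) : Prop where
  base : ∀ f g : C^∞⟮𝓡 n, M; ℝ⟯, W.bracket (f ∘ proj) (g ∘ proj) = w.bracket f g ∘ proj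
  mixed : ∀ (X : VectorField (𝓡 n) M) (f : C^∞⟮𝓡 n, M; ℝ⟯),
    W.bracket (momentum X) (f ∘ proj) = -momentum (D.toFun (differential f) X)
  momenta : ∀ X Y : VectorField (𝓡 n) M,
    W.bracket (momentum X) (momentum Y) = quadratic (Ψ X Y)

end Cotangent

end CotangentLift

/-! The differentials of the functions `f ∘ proj` and `momentum X` span every cotangent space of
`T*M`, because the coordinates `xⁱ` and `p_i` are locally of this kind. A bivector field is
therefore known from its brackets on these functions (`IsDefinedBy.unique`). For a lift, gradedness
and `π`-relatedness force these brackets to be a pulled back function, a momentum and a quadratic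
polynomial. As `momentum` and `quadratic` are injective, `D` and `Ψ` can be read off
(`IsGradedSemiPoissonLift.exists_isDefinedBy`).

The Leibniz rule of the bracket makes `D` a contravariant connection and gives `Ψ(X, fY) = f Ψ(X, Y)
- D_{df}X ⊙ Y`. Conversely, this rule with skewness and additivity (`IsBracketOperator`) suffices to
construct `W`. The bracket prescribed on the functions `f + m(X)` obeys the same Leibniz rule as
their differentials, so both expand in a local frame with the same coefficients. Hence its value at
a point depends only on the differentials there and is given by a bivector
(`IsBracketOperator.exists_isDefinedBy`). The result is graded since momenta and quadratic
polynomials are homogeneous in the fibre. It is semi-Poisson since foliated functions come from `M`,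
where the Jacobi identity is that of `w`.

The rest is affine. Two connections share the term `(α^♯ f) X`, so they differ by a tensor `τ`. Then
`Ψ - Ψ₀` has the symbol `-τ(df, X) ⊙ Y`, and subtracting an operator `A` with this symbol leaves a
tensor `T`. Such an `A` is built in local frames by differentiating components, and glued by a
partition of unity (`exists_isSkewOperatorWithSymbol`). -/

namespace CotangentLift

/-! ### Cutoff functions and local frames made of global sections. -/

section Frames

variable {E : Type*} [NormedAddCommGroup E] [NormedSpace ℝ E]
  {H : Type*} [TopologicalSpace H] {I : ModelWithCorners ℝ E H}
  {M : Type*} [TopologicalSpace M] [ChartedSpace H M] [IsManifold I ∞ M]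

theorem mvfderiv_clm_comp_extChartAt {x₀ x : M} (hx : x ∈ (extChartAt I x₀).source)
    (φ : E →L[ℝ] ℝ) (v : TangentSpace I x) :
    mvfderiv I (fun x => φ (extChartAt I x₀ x)) x v = φ (mfderiv I 𝓘(ℝ, E) (extChartAt I x₀) x v) := by
  rw [extChartAt_source] at hx
  have hφ : MDifferentiableAt 𝓘(ℝ, E) 𝓘(ℝ) φ (extChartAt I x₀ x) :=
    φ.contMDiff.contMDiffAt.mdifferentiableAt one_ne_zero
  refine (mvfderiv_comp_apply x hφ (mdifferentiableAt_extChartAt hx) v).trans ?_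
  simp [mvfderiv, mfderiv_eq_fderiv]
  rfl

variable [FiniteDimensional ℝ E] [T2Space M]

/-- Every neighbourhood carries a smooth function which is supported in it and equal to `1` near
the given point. -/
theorem exists_cutoff {y : M} {U : Set M} (hU : U ∈ 𝓝 y) :
    ∃ ρ : C^∞⟮I, M; ℝ⟯, (ρ : M → ℝ) =ᶠ[𝓝 y] 1 ∧ tsupport ρ ⊆ U := by
  obtain ⟨f, -, hf⟩ := (SmoothBumpFunction.nhds_basis_tsupport (I := I) y).mem_iff.1 hU
  exact ⟨⟨f, f.contMDiff⟩, f.eventuallyEq_one, hf⟩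

theorem exists_function_extension {f : M → ℝ} {U : Set M} (hU : IsOpen U)
    (hf : ContMDiffOn I 𝓘(ℝ) ∞ f U) {y : M} (hy : y ∈ U) :
    ∃ g : C^∞⟮I, M; ℝ⟯, (g : M → ℝ) =ᶠ[𝓝 y] f := by
  obtain ⟨ρ, h1, hρ⟩ := exists_cutoff (I := I) (hU.mem_nhds hy)
  refine ⟨⟨fun x => ρ x • f x, ?_⟩, ?_⟩
  · refine contMDiff_of_tsupport fun x hx => ?_
    have hx' : x ∈ U := hρ (closure_mono (Function.support_smul_subset_left _ _) hx)
    exact ρ.contMDiff.contMDiffAt.smul (hf.contMDiffAt (hU.mem_nhds hx'))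
  · filter_upwards [h1] with x hx
    change ρ x • f x = f x
    rw [hx]; simp

theorem exists_vectorField_extension {X : ∀ x : M, TangentSpace I x} {U : Set M} (hU : IsOpen U)
    (hX : ContMDiffOn I (I.prod 𝓘(ℝ, E)) ∞ (fun x => TotalSpace.mk' E x (X x)) U)
    {y : M} (hy : y ∈ U) :
    ∃ Y : VectorField I M, ∀ᶠ x in 𝓝 y, Y x = X x := by
  obtain ⟨ρ, h1, hρ⟩ := exists_cutoff (I := I) (hU.mem_nhds hy)
  refine ⟨⟨fun x => ρ x • X x, ?_⟩, ?_⟩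
  · exact ContMDiffOn.smul_section_of_tsupport ρ.contMDiff.contMDiffOn hU hρ hX
  · filter_upwards [h1] with x hx
    change ρ x • X x = X x
    rw [hx]; simp

variable (I) in
/-- A finite family of smooth functions and vector fields on `M` which restricts to the coordinates
and to the coordinate vector fields of a chart near `y`, up to a cutoff function. -/
structure LocalFrame (ι : Type*) [Fintype ι] (y : M) where
  /-- the extended coordinates -/
  coord : ι → C^∞⟮I, M; ℝ⟯
  /-- the extended coordinate vector fields -/
  frame : ι → VectorField I M
  /-- the cutoff function -/
  cutoff : C^∞⟮I, M; ℝ⟯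
  cutoff_eq : (cutoff : M → ℝ) =ᶠ[𝓝 y] 1
  cutoff_smul : ∀ (x : M) (v : TangentSpace I x),
    cutoff x • v = ∑ i, mvfderiv I (coord i) x v • frame i x

theorem exists_localFrame [I.Boundaryless] {ι : Type*} [Fintype ι] (b : Module.Basis ι ℝ E)
    {x₀ y : M} (hy : y ∈ (extChartAt I x₀).source) :
    ∃ F : LocalFrame I ι y,
      (∀ i, (F.coord i : M → ℝ) =ᶠ[𝓝 y] fun x => b.coord i (extChartAt I x₀ x)) ∧
      ∀ i, ∀ᶠ x in 𝓝 y, F.frame i x =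
        mfderiv 𝓘(ℝ, E) I (extChartAt I x₀).symm (extChartAt I x₀ x) (b i) := by
  set e := trivializationAt E (TangentSpace I : M → Type _) x₀ with he
  have hbase : e.baseSet = (extChartAt I x₀).source := by
    rw [extChartAt_source, he, TangentBundle.trivializationAt_baseSet]
  have hframe : ∀ i, ∀ x ∈ (extChartAt I x₀).source, e.localFrame b i x =
      mfderiv 𝓘(ℝ, E) I (extChartAt I x₀).symm (extChartAt I x₀ x) (b i) := by
    intro i x hx
    have hx' : x ∈ (chartAt H x₀).source := by rwa [extChartAt_source] at hx
    rw [e.localFrame_apply_of_mem_baseSet b (hbase ▸ hx), ← mfderivWithin_univ, ← I.range_eq_univ,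
      ← TangentBundle.symmL_trivializationAt hx']
    simp only [Trivialization.basisAt, Module.Basis.map_apply, ← he]
    exact (e.symmL_apply (hbase ▸ hx) (b i)).symm
  have hc : ∀ i, ∃ g : C^∞⟮I, M; ℝ⟯,
      (g : M → ℝ) =ᶠ[𝓝 y] fun x => b.coord i (extChartAt I x₀ x) := fun i =>
    exists_function_extension (isOpen_extChartAt_source x₀)
      ((b.coord i).toContinuousLinearMap.contMDiff.comp_contMDiffOn
        (extChartAt_source I x₀ ▸ contMDiffOn_extChartAt)) hy
  have hX : ∀ i, ∃ X : VectorField I M, ∀ᶠ x in 𝓝 y, X x = e.localFrame b i x := fun i =>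
    exists_vectorField_extension (isOpen_extChartAt_source x₀)
      (hbase ▸ e.contMDiffOn_localFrame_baseSet (I := I) ∞ b i) hy
  choose c hc using hc
  choose X hX using hX
  -- For the coordinates equality of germs is required, since their derivatives are compared at
  -- every point of the support of `ρ`. For the frame equality of values is enough.
  have hU : {x | x ∈ (extChartAt I x₀).source ∧
      (∀ i, (c i : M → ℝ) =ᶠ[𝓝 x] fun x => b.coord i (extChartAt I x₀ x)) ∧
      ∀ i, X i x = e.localFrame b i x} ∈ 𝓝 y := by
    filter_upwards [(isOpen_extChartAt_source (I := I) x₀).mem_nhds hy,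
      Filter.eventually_all.2 fun i => eventually_eventually_nhds.2 (hc i),
      Filter.eventually_all.2 hX] with x h1 h2 h3
    exact ⟨h1, h2, h3⟩
  obtain ⟨ρ, hρ1, hρ⟩ := exists_cutoff (I := I) hU
  -- The factor `ρ` in the frame makes the expansion valid on all of `M`: on the support of `ρ` it
  -- is `ρ` times the expansion in the chart, and elsewhere both sides vanish.
  refine ⟨⟨c, fun i => ρ • X i, ρ, hρ1, ?_⟩, hc, ?_⟩
  · intro x v
    by_cases hx : x ∈ tsupport ρ
    · obtain ⟨hxs, hcx, hXx⟩ := hρ hx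
      have hv : v = ∑ i, mvfderiv I (c i) x v • X i x := by
        have hm := mfderivWithin_extChartAt_symm_comp_mfderiv_extChartAt' (I := I) hxs
        have hv' := b.sum_repr (mfderiv I 𝓘(ℝ, E) (extChartAt I x₀) x v)
        have : ∀ i, mvfderiv I (c i) x v • X i x =
            mfderivWithin 𝓘(ℝ, E) I (extChartAt I x₀).symm (Set.range I) (extChartAt I x₀ x)
              (b.repr (mfderiv I 𝓘(ℝ, E) (extChartAt I x₀) x v) i • b i) := by
          intro i
          have h1 : mvfderiv I (c i) x v = b.repr (mfderiv I 𝓘(ℝ, E) (extChartAt I x₀) x v) i := by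
            have h2 : mvfderiv I (c i) x = mvfderiv I (fun x => b.coord i (extChartAt I x₀ x)) x := by
              simp only [mvfderiv]
              rw [(hcx i).mfderiv_eq]
              rfl
            rw [h2]
            exact mvfderiv_clm_comp_extChartAt hxs (b.coord i).toContinuousLinearMap v
          rw [h1, hXx, hframe i x hxs, I.range_eq_univ, mfderivWithin_univ]
          exact (map_smul _ _ _).symm
        rw [Finset.sum_congr rfl fun i _ => this i]
        erw [← map_sum, hv']
        exact (DFunLike.congr_fun hm v).symm
      change _ = ∑ i, _ • (ρ x • X i x)
      conv_lhs => rw [hv, Finset.smul_sum]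
      exact Finset.sum_congr rfl fun i _ => smul_comm _ _ _
    · have h0 : ρ x = 0 := image_eq_zero_of_notMem_tsupport hx
      change _ = ∑ i, _ • (ρ x • X i x)
      simp [h0]
  · intro i
    filter_upwards [hρ1, hX i, (isOpen_extChartAt_source (I := I) x₀).mem_nhds hy] with x h1 h2 h3
    change ρ x • X i x = _
    rw [h1, h2, hframe i x h3]
    exact one_smul ℝ _

end Frames

/-! ### Sections, differentials and brackets at a point. -/

section Pointwise

variable {E : Type*} [NormedAddCommGroup E] [NormedSpace ℝ E]
  {H : Type*} [TopologicalSpace H] {I : ModelWithCorners ℝ E H}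
  {M : Type*} [TopologicalSpace M] [ChartedSpace H M]

section Sections

variable {F : Type*} [NormedAddCommGroup F] [NormedSpace ℝ F]
  {V : M → Type*} [TopologicalSpace (TotalSpace F V)] [∀ x, TopologicalSpace (V x)]
  [FiberBundle F V] [∀ x, AddCommGroup (V x)] [∀ x, Module ℝ (V x)] [VectorBundle ℝ F V]

theorem section_smul_apply (f : C^∞⟮I, M; ℝ⟯) (s : Cₛ^∞⟮I; F, V⟯) (x : M) :
    (f • s) x = f x • s x := rfl

theorem section_sum_apply {ι : Type*} (t : Finset ι) (s : ι → Cₛ^∞⟮I; F, V⟯) (x : M) :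
    (∑ i ∈ t, s i) x = ∑ i ∈ t, s i x := by
  have := map_sum (ContMDiffSection.coeAddHom I F ∞ V) s t
  exact (congrFun this x).trans (Finset.sum_apply _ _ _)

theorem section_const_smul (c : ℝ) (s : Cₛ^∞⟮I; F, V⟯) :
    c • s = (ContMDiffMap.const c : C^∞⟮I, M; ℝ⟯) • s := rfl

end Sections

theorem smooth_mdifferentiableAt (f : C^∞⟮I, M; ℝ⟯) (x : M) : MDifferentiableAt I 𝓘(ℝ) f x :=
  f.contMDiff.contMDiffAt.mdifferentiableAt (by simp)

theorem mvfderiv_congr {f g : M → ℝ} {x : M} (h : f =ᶠ[𝓝 x] g) :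
    mvfderiv I f x = mvfderiv I g x := by
  have h0 := h.eq_of_nhds
  ext v
  simp only [mvfderiv, ContinuousLinearMap.comp_apply]
  rw [h.mfderiv_eq]
  rfl

theorem mvfderiv_eq_zero_of_eventually_one {f : M → ℝ} {x : M} (h : f =ᶠ[𝓝 x] 1) :
    mvfderiv I f x = 0 := by
  rw [mvfderiv_congr h]
  exact mvfderiv_const 1

theorem mvfderiv_sum {ι : Type*} (t : Finset ι) {f : ι → M → ℝ} {x : M}
    (hf : ∀ i ∈ t, MDifferentiableAt I 𝓘(ℝ) (f i) x) :
    mvfderiv I (∑ i ∈ t, f i) x = ∑ i ∈ t, mvfderiv I (f i) x := by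
  classical
  -- Differentiability of the partial sums is carried through the induction, because `mvfderiv_add`
  -- needs it.
  suffices h : MDifferentiableAt I 𝓘(ℝ) (∑ i ∈ t, f i) x ∧
      mvfderiv I (∑ i ∈ t, f i) x = ∑ i ∈ t, mvfderiv I (f i) x from h.2
  induction t using Finset.induction_on with
  | empty =>
    simp only [Finset.sum_empty, mvfderiv_zero, and_true]
    exact mdifferentiableAt_const
  | insert i t hi ih =>
    obtain ⟨h1, h2⟩ := ih fun j hj => hf j (Finset.mem_insert_of_mem hj)
    have h3 := hf i (Finset.mem_insert_self i t)
    rw [Finset.sum_insert hi, Finset.sum_insert hi, mvfderiv_add h3 h1, h2]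
    exact ⟨h3.add h1, rfl⟩

theorem eq_of_forall_covector {x : M} {u v : TangentSpace I x}
    (h : ∀ α : TangentSpace I x →L[ℝ] ℝ, α u = α v) : u = v :=
  (SeparatingDual.eq_iff_forall_dual_eq (R := ℝ) (V := E)).2 h

variable [IsManifold I ∞ M]

/-- A `2`-contravariant tensor at a point, as a bilinear form on covectors. -/
def ContraTwo.form (Q : ContraTwo I M) (x : M) :
    (TangentSpace I x →L[ℝ] ℝ) →ₗ[ℝ] (TangentSpace I x →L[ℝ] ℝ) →ₗ[ℝ] ℝ :=
  LinearMap.mk₂ ℝ (fun α β => Q.val x α β) (fun α α' β => by simp [ContraTwo.val])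
    (fun c α β => by simp [ContraTwo.val]) (fun α β β' => by simp [ContraTwo.val])
    (fun c α β => by simp [ContraTwo.val])

/-- The smooth function `α(X)`. -/
def contract (α : OneForm I M) (X : VectorField I M) : C^∞⟮I, M; ℝ⟯ :=
  ⟨fun x => α x (X x), by
    intro x
    have h := ContMDiffAt.clm_bundle_apply (E₂ := Bundle.Trivial M ℝ) (F₂ := ℝ)
      (α.contMDiff x) (X.contMDiff x)
    rw [contMDiffAt_section] at h
    exact h⟩

theorem contract_apply (α : OneForm I M) (X : VectorField I M) (x : M) :
    contract α X x = α x (X x) := rfl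

theorem differential_apply (f : C^∞⟮I, M; ℝ⟯) (x : M) : differential f x = mvfderiv I f x := rfl

theorem differential_add (f g : C^∞⟮I, M; ℝ⟯) :
    differential (f + g) = differential f + differential g := by
  ext1 x
  exact mvfderiv_add (smooth_mdifferentiableAt f x) (smooth_mdifferentiableAt g x)

theorem differential_mul (f g : C^∞⟮I, M; ℝ⟯) :
    differential (f * g) = f • differential g + g • differential f := by
  ext1 x
  exact mvfderiv_mul (smooth_mdifferentiableAt f x) (smooth_mdifferentiableAt g x)

theorem differential_const (c : ℝ) :
    differential (ContMDiffMap.const c : C^∞⟮I, M; ℝ⟯) = 0 := by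
  ext1 x
  exact mvfderiv_const c

theorem differential_const_smul (c : ℝ) (f : C^∞⟮I, M; ℝ⟯) :
    differential (c • f) = (ContMDiffMap.const c : C^∞⟮I, M; ℝ⟯) • differential f := by
  have : c • f = (ContMDiffMap.const c : C^∞⟮I, M; ℝ⟯) * f := rfl
  rw [this, differential_mul, differential_const]
  ext1 x
  change c • mvfderiv I f x + f x • (0 : TangentSpace I x →L[ℝ] ℝ) = c • mvfderiv I f x
  rw [smul_zero, add_zero]

namespace BivectorField

variable (W : BivectorField I M)

theorem bracket_eq_form (F G : M → ℝ) (x : M) :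
    W.bracket F G x = W.tensor.form x (mvfderiv I F x) (mvfderiv I G x) := rfl

theorem pair_apply (α β : OneForm I M) (x : M) :
    W.pair α β x = W.tensor.form x (α x) (β x) := rfl

theorem form_skew (x : M) (α β : TangentSpace I x →L[ℝ] ℝ) :
    W.tensor.form x α β = -W.tensor.form x β α := W.skew x α β

theorem bracket_skew (F G : M → ℝ) : W.bracket F G = -W.bracket G F := by
  ext x
  exact W.skew x _ _

theorem bracket_congr {F F' G G' : M → ℝ} {x : M} (hF : F =ᶠ[𝓝 x] F') (hG : G =ᶠ[𝓝 x] G') :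
    W.bracket F G x = W.bracket F' G' x := by
  rw [bracket_eq_form, mvfderiv_congr hF, mvfderiv_congr hG, ← bracket_eq_form]

theorem bracket_mul_right {F G G' : M → ℝ} {x : M} (hG : MDifferentiableAt I 𝓘(ℝ) G x)
    (hG' : MDifferentiableAt I 𝓘(ℝ) G' x) :
    W.bracket F (G * G') x = G x * W.bracket F G' x + G' x * W.bracket F G x := by
  simp only [bracket_eq_form, mvfderiv_mul hG hG', map_add, map_smul, smul_eq_mul]

theorem bracket_add_right {F G G' : M → ℝ} {x : M} (hG : MDifferentiableAt I 𝓘(ℝ) G x)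
    (hG' : MDifferentiableAt I 𝓘(ℝ) G' x) :
    W.bracket F (G + G') x = W.bracket F G x + W.bracket F G' x := by
  simp only [bracket_eq_form, mvfderiv_add hG hG', map_add]

theorem bracket_smooth (f g : C^∞⟮I, M; ℝ⟯) :
    W.bracket f g = W.pair (differential f) (differential g) := rfl

end BivectorField

theorem ContraTwo.ext_form {P Q : ContraTwo I M} (h : ∀ x α β, P.form x α β = Q.form x α β) :
    P = Q := by
  ext1 x
  refine ContinuousLinearMap.ext fun α => ?_
  exact eq_of_forall_covector fun β => h x α β

theorem BivectorField.ext_form {P Q : BivectorField I M}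
    (h : ∀ x α β, P.tensor.form x α β = Q.tensor.form x α β) : P = Q := by
  cases P; cases Q
  congr
  exact ContraTwo.ext_form h

end Pointwise

/-! ### Expansions in a local frame. -/

namespace LocalFrame

variable {E : Type*} [NormedAddCommGroup E] [NormedSpace ℝ E]
  {H : Type*} [TopologicalSpace H] {I : ModelWithCorners ℝ E H}
  {M : Type*} [TopologicalSpace M] [ChartedSpace H M] [IsManifold I ∞ M]
  {ι : Type*} [Fintype ι] {y : M} (F : LocalFrame I ι y)

/-- The components of a vector field. -/
def comp (X : VectorField I M) (i : ι) : C^∞⟮I, M; ℝ⟯ := contract (differential (F.coord i)) X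

/-- Unlike an expansion in a chart, this is an identity of global sections, so operators that act
only on global vector fields can be applied to it. -/
theorem cutoff_smul_vectorField (X : VectorField I M) :
    F.cutoff • X = ∑ i, F.comp X i • F.frame i := by
  ext1 x
  rw [section_sum_apply]
  exact F.cutoff_smul x (X x)

theorem cutoff_smul_oneForm (α : OneForm I M) :
    F.cutoff • α = ∑ i, contract α (F.frame i) • differential (F.coord i) := by
  ext1 x
  refine ContinuousLinearMap.ext fun v => ?_
  have h := congrArg (α x) (F.cutoff_smul x v)
  rw [section_sum_apply]
  simp only [map_smul, map_sum, smul_eq_mul] at h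
  simp only [section_smul_apply, _root_.sum_apply, _root_.smul_apply,
    smul_eq_mul, contract_apply, differential_apply]
  refine h.trans (Finset.sum_congr rfl fun i _ => mul_comm _ _)

theorem cutoff_eq_one : F.cutoff y = 1 := F.cutoff_eq.eq_of_nhds

theorem mvfderiv_cutoff : mvfderiv I F.cutoff y = 0 :=
  mvfderiv_eq_zero_of_eventually_one F.cutoff_eq

theorem covector_eq_sum {x : M} (hx : F.cutoff x = 1) (γ : TangentSpace I x →L[ℝ] ℝ) :
    γ = ∑ i, γ (F.frame i x) • mvfderiv I (F.coord i) x := by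
  refine ContinuousLinearMap.ext fun v => ?_
  have h := congrArg γ (F.cutoff_smul x v)
  simp only [map_smul, map_sum, smul_eq_mul, hx, one_smul] at h
  simp only [_root_.sum_apply, _root_.smul_apply, smul_eq_mul]
  exact h.trans (Finset.sum_congr rfl fun i _ => mul_comm _ _)

end LocalFrame

/-! ### Fibrewise polynomial functions on `T*M`. -/

section Polynomials

variable {n : ℕ} {M : Type*} [TopologicalSpace M] [ChartedSpace (EuclideanSpace ℝ (Fin n)) M]
  [IsManifold (𝓡 n) ∞ M]

theorem momentum_apply (X : VectorField (𝓡 n) M) (z : CotangentBundle n M) :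
    momentum X z = z.2 (X z.1) := rfl

theorem momentum_add (X Y : VectorField (𝓡 n) M) :
    momentum (X + Y) = momentum X + momentum Y := by
  ext z
  exact map_add z.2 (X z.1) (Y z.1)

theorem momentum_neg (X : VectorField (𝓡 n) M) : momentum (-X) = -momentum X := by
  ext z
  exact map_neg z.2 (X z.1)

theorem momentum_smul (f : C^∞⟮𝓡 n, M; ℝ⟯) (X : VectorField (𝓡 n) M) :
    momentum (f • X) = (f ∘ proj) * momentum X := by
  ext z
  exact map_smul z.2 (f z.1) (X z.1)

theorem momentum_sum {ι : Type*} (t : Finset ι) (X : ι → VectorField (𝓡 n) M) :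
    momentum (∑ i ∈ t, X i) = ∑ i ∈ t, momentum (X i) := by
  ext z
  rw [momentum_apply, section_sum_apply, map_sum, Finset.sum_apply]
  rfl

theorem momentum_injective : Function.Injective (momentum (n := n) (M := M)) := by
  intro X Y h
  ext1 x
  exact eq_of_forall_covector fun α => congrFun h ⟨x, α⟩

theorem quadratic_apply (Q : SymTwo (𝓡 n) M) (z : CotangentBundle n M) :
    quadratic Q z = (Q : ContraTwo (𝓡 n) M).form z.1 z.2 z.2 := rfl

theorem quadratic_add (P Q : SymTwo (𝓡 n) M) : quadratic (P + Q) = quadratic P + quadratic Q := by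
  ext z
  exact map_add z.2 ((P : ContraTwo (𝓡 n) M) z.1 z.2) ((Q : ContraTwo (𝓡 n) M) z.1 z.2)

theorem quadratic_sub (P Q : SymTwo (𝓡 n) M) : quadratic (P - Q) = quadratic P - quadratic Q := by
  ext z
  exact map_sub z.2 ((P : ContraTwo (𝓡 n) M) z.1 z.2) ((Q : ContraTwo (𝓡 n) M) z.1 z.2)

theorem quadratic_neg (Q : SymTwo (𝓡 n) M) : quadratic (-Q) = -quadratic Q := by
  ext z
  exact map_neg z.2 ((Q : ContraTwo (𝓡 n) M) z.1 z.2)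

theorem quadratic_zero : quadratic (0 : SymTwo (𝓡 n) M) = 0 := by
  ext z
  exact map_zero z.2

theorem quadratic_smul (f : C^∞⟮𝓡 n, M; ℝ⟯) (Q : SymTwo (𝓡 n) M) :
    quadratic (f • Q) = (f ∘ proj) * quadratic Q := by
  ext z
  exact map_smul z.2 (f z.1) ((Q : ContraTwo (𝓡 n) M) z.1 z.2)

theorem quadratic_sum {ι : Type*} (t : Finset ι) (Q : ι → SymTwo (𝓡 n) M) :
    quadratic (∑ i ∈ t, Q i) = ∑ i ∈ t, quadratic (Q i) := by
  classical
  induction t using Finset.induction_on with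
  | empty => exact quadratic_zero
  | insert i t hi ih => rw [Finset.sum_insert hi, Finset.sum_insert hi, ← ih]; exact quadratic_add _ _

theorem quadratic_symProd (X Y : VectorField (𝓡 n) M) :
    quadratic (symProd X Y) = momentum X * momentum Y := by
  ext z
  change z.2 ((1 / 2 : ℝ) • (z.2 (X z.1) • Y z.1 + z.2 (Y z.1) • X z.1)) = z.2 (X z.1) * z.2 (Y z.1)
  simp only [map_smul, map_add, smul_eq_mul]
  ring

theorem SymTwo.form_symm (Q : SymTwo (𝓡 n) M) (x : M) (α β : TangentSpace (𝓡 n) x →L[ℝ] ℝ) :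
    (Q : ContraTwo (𝓡 n) M).form x α β = (Q : ContraTwo (𝓡 n) M).form x β α := Q.2 x α β

/-- By polarization. Together with `momentum_injective` it reduces identities between tensor fields
to identities between functions on `T*M`, where `ring` applies. -/
theorem quadratic_injective : Function.Injective (quadratic (n := n) (M := M)) := by
  intro P Q h
  have h' : ∀ (x : M) (α : TangentSpace (𝓡 n) x →L[ℝ] ℝ),
      (P : ContraTwo (𝓡 n) M).form x α α = (Q : ContraTwo (𝓡 n) M).form x α α :=
    fun x α => congrFun h ⟨x, α⟩
  refine Subtype.ext (ContraTwo.ext_form fun x α β => ?_)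
  have h1 := h' x (α + β)
  simp only [map_add, LinearMap.add_apply, h' x α, h' x β] at h1
  rw [SymTwo.form_symm P x β α, SymTwo.form_symm Q x β α] at h1
  linarith

theorem contMDiff_proj : ContMDiff (cotangentModel n) (𝓡 n) ∞ (proj (n := n) (M := M)) :=
  Bundle.contMDiff_proj _

/-- The pullback of a smooth function to `T*M`. -/
def pullback (f : C^∞⟮𝓡 n, M; ℝ⟯) : C^∞⟮cotangentModel n, CotangentBundle n M; ℝ⟯ :=
  ⟨f ∘ proj, f.contMDiff.comp contMDiff_proj⟩

theorem contMDiff_momentum (X : VectorField (𝓡 n) M) :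
    ContMDiff (cotangentModel n) 𝓘(ℝ) ∞ (momentum X) := by
  intro z
  -- The identity of `T*M` is read as the tautological covector field along `proj`, which is then
  -- contracted with `X`.
  have hz : ContMDiffAt (cotangentModel n) (cotangentModel n) ∞
      (fun z : CotangentBundle n M => TotalSpace.mk' (EuclideanSpace ℝ (Fin n) →L[ℝ] ℝ)
        (E := fun x : M => TangentSpace (𝓡 n) x →L[ℝ] ℝ) (proj z) z.2) z := contMDiffAt_id
  have h := ContMDiffAt.clm_bundle_apply (E₂ := Bundle.Trivial M ℝ) (F₂ := ℝ) hz
    (X.contMDiff.comp contMDiff_proj z)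
  rw [contMDiffAt_totalSpace] at h
  exact h.2

theorem contMDiff_quadratic (Q : SymTwo (𝓡 n) M) :
    ContMDiff (cotangentModel n) 𝓘(ℝ) ∞ (quadratic Q) := by
  intro z
  have hz : ContMDiffAt (cotangentModel n) (cotangentModel n) ∞
      (fun z : CotangentBundle n M => TotalSpace.mk' (EuclideanSpace ℝ (Fin n) →L[ℝ] ℝ)
        (E := fun x : M => TangentSpace (𝓡 n) x →L[ℝ] ℝ) (proj z) z.2) z := contMDiffAt_id
  have h1 := ContMDiffAt.clm_bundle_apply
    ((Q : ContraTwo (𝓡 n) M).contMDiff.comp contMDiff_proj z) hz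
  have h := ContMDiffAt.clm_bundle_apply (E₂ := Bundle.Trivial M ℝ) (F₂ := ℝ) hz h1
  rw [contMDiffAt_totalSpace] at h
  exact h.2

/-- The momentum of a vector field, as a smooth function. -/
def smoothMomentum (X : VectorField (𝓡 n) M) : C^∞⟮cotangentModel n, CotangentBundle n M; ℝ⟯ :=
  ⟨momentum X, contMDiff_momentum X⟩

theorem mdifferentiableAt_momentum (X : VectorField (𝓡 n) M) (z : CotangentBundle n M) :
    MDifferentiableAt (cotangentModel n) 𝓘(ℝ) (momentum X) z :=
  smooth_mdifferentiableAt (smoothMomentum X) z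

theorem mdifferentiableAt_pullback (f : C^∞⟮𝓡 n, M; ℝ⟯) (z : CotangentBundle n M) :
    MDifferentiableAt (cotangentModel n) 𝓘(ℝ) (f ∘ proj) z :=
  smooth_mdifferentiableAt (pullback f) z

theorem mvfderiv_pullback (f : C^∞⟮𝓡 n, M; ℝ⟯) (z : CotangentBundle n M) :
    mvfderiv (cotangentModel n) (f ∘ proj) z =
      (mvfderiv (𝓡 n) f (proj z)).comp (mfderiv (cotangentModel n) (𝓡 n) proj z) :=
  mvfderiv_comp z (smooth_mdifferentiableAt f _)
    (contMDiff_proj.contMDiffAt.mdifferentiableAt (by simp))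

end Polynomials

/-! ### The coordinates `(x, p)` of the cotangent bundle. -/

section CotangentChart

variable {n : ℕ} {M : Type*} [TopologicalSpace M] [ChartedSpace (EuclideanSpace ℝ (Fin n)) M]
  [IsManifold (𝓡 n) ∞ M]

/-- The trivialization of the bundle of covectors precomposes a covector with the inverse of the
tangent trivialization. That inverse is the derivative of the inverse chart, so it sends the
standard basis to the coordinate vectors. -/
theorem extChartAt_cotangentBundle {z₀ z : CotangentBundle n M}
    (hz : proj z ∈ (extChartAt (𝓡 n) (proj z₀)).source) :
    (extChartAt (cotangentModel n) z₀ z).1 = extChartAt (𝓡 n) (proj z₀) (proj z) ∧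
      ∀ i, (extChartAt (cotangentModel n) z₀ z).2 (EuclideanSpace.single i 1) =
        coordP (proj z₀) i z := by
  have hz' : proj z ∈ (chartAt (EuclideanSpace ℝ (Fin n)) (proj z₀)).source := by
    rwa [extChartAt_source] at hz
  have hb : proj z ∈ (trivializationAt (EuclideanSpace ℝ (Fin n))
      (TangentSpace (𝓡 n) : M → Type _) (proj z₀)).baseSet := by
    rwa [TangentBundle.trivializationAt_baseSet]
  rw [FiberBundle.extChartAt]
  refine ⟨rfl, fun i => ?_⟩
  change (trivializationAt _ _ (proj z₀) z).2 _ = _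
  rw [hom_trivializationAt_apply]
  obtain ⟨x, α⟩ := z
  have h := ContinuousLinearMap.inCoordinates_eq (ϕ := α)
    (F' := ℝ) (E' := Bundle.Trivial M ℝ) (y₀ := proj z₀) (y := x) hb (by trivial)
  refine (congrArg (fun L => L (EuclideanSpace.single i 1)) h).trans ?_
  rw [coordP, coordVector, ← mfderivWithin_univ, ← (𝓡 n).range_eq_univ]
  have h' := TangentBundle.symmL_trivializationAt (I := 𝓡 n) hz'
  exact congrArg α (((Trivialization.symmL_apply (R := ℝ) _ hb _).symm).trans
    (DFunLike.congr_fun h' (EuclideanSpace.single i (1 : ℝ))))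

/-- The standard basis of the model space. -/
abbrev stdBasis (n : ℕ) : Module.Basis (Fin n) ℝ (EuclideanSpace ℝ (Fin n)) :=
  (EuclideanSpace.basisFun (Fin n) ℝ).toBasis

/-- A local frame agrees with the coordinates of the chart at `x₀` near `y'`. -/
structure LocalFrame.Extends {y : M} (F : LocalFrame (𝓡 n) (Fin n) y) (x₀ y' : M) : Prop where
  coord_eq : ∀ i, (F.coord i : M → ℝ) =ᶠ[𝓝 y'] fun x => extChartAt (𝓡 n) x₀ x i
  frame_eq : ∀ i, ∀ᶠ x in 𝓝 y', F.frame i x = coordVector x₀ x i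

theorem LocalFrame.Extends.eventually {y x₀ y' : M} {F : LocalFrame (𝓡 n) (Fin n) y}
    (h : F.Extends x₀ y') : ∀ᶠ x in 𝓝 y', F.Extends x₀ x := by
  filter_upwards [Filter.eventually_all.2 fun i => eventually_eventually_nhds.2 (h.coord_eq i),
    Filter.eventually_all.2 fun i => eventually_eventually_nhds.2 (h.frame_eq i)] with x h1 h2
  exact ⟨h1, h2⟩

theorem eventually_proj {p : M → Prop} {z : CotangentBundle n M} (h : ∀ᶠ x in 𝓝 (proj z), p x) :
    ∀ᶠ z' in 𝓝 z, p (proj z') :=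
  (contMDiff_proj.continuous.tendsto z).eventually h

variable {y : M} {z : CotangentBundle n M} {F : LocalFrame (𝓡 n) (Fin n) y}

theorem LocalFrame.Extends.coordX_eq {x₀ : M} (hF : F.Extends x₀ (proj z)) (i : Fin n) :
    coordX x₀ i =ᶠ[𝓝 z] F.coord i ∘ proj := by
  filter_upwards [eventually_proj (hF.coord_eq i)] with z' hz'
  exact hz'.symm

theorem LocalFrame.Extends.coordP_eq {x₀ : M} (hF : F.Extends x₀ (proj z)) (i : Fin n) :
    coordP x₀ i =ᶠ[𝓝 z] momentum (F.frame i) := by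
  filter_upwards [eventually_proj (hF.frame_eq i)] with z' hz'
  exact congrArg z'.2 hz'.symm

theorem eventually_mem_chart (z : CotangentBundle n M) :
    ∀ᶠ z' in 𝓝 z, proj z' ∈ (extChartAt (𝓡 n) (proj z)).source :=
  eventually_proj (extChartAt_source_mem_nhds _)

/-- The linear coordinates of the model space of `T*M`. -/
def modelCoord (n : ℕ) : Fin n ⊕ Fin n →
    (EuclideanSpace ℝ (Fin n) × (EuclideanSpace ℝ (Fin n) →L[ℝ] ℝ) →L[ℝ] ℝ) :=
  Sum.elim (fun i => (EuclideanSpace.proj i).comp (ContinuousLinearMap.fst ℝ _ _))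
    fun i => (ContinuousLinearMap.apply ℝ ℝ (EuclideanSpace.single i 1)).comp
      (ContinuousLinearMap.snd ℝ _ _)

theorem modelCoord_inl (i : Fin n) (u : EuclideanSpace ℝ (Fin n))
    (β : EuclideanSpace ℝ (Fin n) →L[ℝ] ℝ) : modelCoord n (Sum.inl i) (u, β) = u i := rfl

theorem modelCoord_inr (i : Fin n) (u : EuclideanSpace ℝ (Fin n))
    (β : EuclideanSpace ℝ (Fin n) →L[ℝ] ℝ) :
    modelCoord n (Sum.inr i) (u, β) = β (EuclideanSpace.single i 1) := rfl

/-- The basis of the model space of `T*M` with the coordinates `modelCoord`. -/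
def modelBasis (n : ℕ) : Module.Basis (Fin n ⊕ Fin n) ℝ
    (EuclideanSpace ℝ (Fin n) × (EuclideanSpace ℝ (Fin n) →L[ℝ] ℝ)) :=
  (stdBasis n).prod ((stdBasis n).dualBasis.map LinearMap.toContinuousLinearMap)

theorem modelBasis_coord (a : Fin n ⊕ Fin n)
    (v : EuclideanSpace ℝ (Fin n) × (EuclideanSpace ℝ (Fin n) →L[ℝ] ℝ)) :
    (modelBasis n).coord a v = modelCoord n a v := by
  obtain ⟨u, β⟩ := v
  rcases a with i | i
  · simp [modelBasis, modelCoord_inl]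
  · simp [modelBasis, modelCoord_inr]

theorem sum_modelCoord_smul
    (v : EuclideanSpace ℝ (Fin n) × (EuclideanSpace ℝ (Fin n) →L[ℝ] ℝ)) :
    ∑ a, modelCoord n a v • modelBasis n a = v := by
  simp only [← modelBasis_coord]
  exact (modelBasis n).sum_repr v

theorem modelCoord_modelBasis (a b : Fin n ⊕ Fin n) :
    modelCoord n a (modelBasis n b) = if b = a then 1 else 0 := by
  rw [← modelBasis_coord, Module.Basis.coord_apply, Module.Basis.repr_self,
    Finsupp.single_apply]

/-- The coordinates of `T*M` which are defined by a local frame of `M`. -/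
def LocalFrame.cotangentCoord (F : LocalFrame (𝓡 n) (Fin n) y) :
    Fin n ⊕ Fin n → C^∞⟮cotangentModel n, CotangentBundle n M; ℝ⟯ :=
  Sum.elim (fun i => pullback (F.coord i)) fun i => smoothMomentum (F.frame i)

theorem cotangentCoord_eventuallyEq (hF : F.Extends (proj z) (proj z)) (a : Fin n ⊕ Fin n) :
    (F.cotangentCoord a : CotangentBundle n M → ℝ) =ᶠ[𝓝 z]
      fun z' => modelCoord n a (extChartAt (cotangentModel n) z z') := by
  rcases a with i | i
  · filter_upwards [hF.coordX_eq i, eventually_mem_chart z] with z' h1 h2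
    refine Eq.trans h1.symm ?_
    change _ = (extChartAt (cotangentModel n) z z').1 i
    rw [(extChartAt_cotangentBundle h2).1]
    rfl
  · filter_upwards [hF.coordP_eq i, eventually_mem_chart z] with z' h1 h2
    exact h1.symm.trans ((extChartAt_cotangentBundle h2).2 i).symm

/-- Near `z` these functions are linear coordinates of the chart centred at `z`, and the derivative
of a chart at its own centre is the identity of the model space. -/
theorem mvfderiv_cotangentCoord (hF : F.Extends (proj z) (proj z)) (a : Fin n ⊕ Fin n) :
    mvfderiv (cotangentModel n) (F.cotangentCoord a) z = modelCoord n a := by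
  refine ContinuousLinearMap.ext fun v => ?_
  rw [mvfderiv_congr (cotangentCoord_eventuallyEq hF a),
    mvfderiv_clm_comp_extChartAt (mem_extChartAt_source z), mfderiv_extChartAt_self]
  rfl

theorem covector_eq_sum_cotangentCoord (hF : F.Extends (proj z) (proj z))
    (θ : TangentSpace (cotangentModel n) z →L[ℝ] ℝ) :
    ∃ c : Fin n ⊕ Fin n → ℝ,
      θ = ∑ a, c a • mvfderiv (cotangentModel n) (F.cotangentCoord a) z := by
  have key : ∀ θ : EuclideanSpace ℝ (Fin n) × (EuclideanSpace ℝ (Fin n) →L[ℝ] ℝ) →L[ℝ] ℝ,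
      θ = ∑ a, θ (modelBasis n a) • modelCoord n a := by
    intro θ
    refine ContinuousLinearMap.ext fun v => ?_
    conv_lhs => rw [← sum_modelCoord_smul v]
    simp [_root_.sum_apply, mul_comm]
  refine ⟨fun a => (show _ →L[ℝ] ℝ from θ) (modelBasis n a),
    (key θ).trans (Finset.sum_congr rfl fun a _ => ?_)⟩
  rw [mvfderiv_cotangentCoord hF]
  rfl

variable [T2Space M]

theorem exists_localFrame_extends {x₀ y : M} (hy : y ∈ (extChartAt (𝓡 n) x₀).source) :
    ∃ F : LocalFrame (𝓡 n) (Fin n) y, F.Extends x₀ y := by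
  obtain ⟨F, h1, h2⟩ := exists_localFrame (I := 𝓡 n) (stdBasis n) hy
  refine ⟨F, h1, fun i => ?_⟩
  filter_upwards [h2 i] with x hx
  rw [hx, coordVector, OrthonormalBasis.coe_toBasis, EuclideanSpace.basisFun_apply]

/-- Bump functions on `T*M`, and with them local frames of `T*M`, need the Hausdorff property.
Points in different fibres are separated by `proj`, points in the same fibre by the momentum of a
frame field. -/
instance t2Space_cotangentBundle : T2Space (CotangentBundle n M) := by
  refine ⟨fun z z' hzz => ?_⟩
  by_cases h : proj z = proj z'
  · obtain ⟨x, α⟩ := z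
    obtain ⟨x', β⟩ := z'
    obtain rfl : x = x' := h
    obtain ⟨F, -⟩ := exists_localFrame_extends (mem_extChartAt_source (I := 𝓡 n) x)
    have : ∃ i, α (F.frame i x) ≠ β (F.frame i x) := by
      by_contra! hc
      refine hzz (congrArg _ ?_)
      rw [F.covector_eq_sum F.cutoff_eq_one α, F.covector_eq_sum F.cutoff_eq_one β]
      simp only [hc]
    obtain ⟨i, hi⟩ := this
    exact separated_by_continuous (contMDiff_momentum (F.frame i)).continuous hi
  · exact separated_by_continuous contMDiff_proj.continuous h

end CotangentChart

/-! ### Pointwise values of differentials and connections. -/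

section General

variable {E : Type*} [NormedAddCommGroup E] [NormedSpace ℝ E]
  {H : Type*} [TopologicalSpace H] {I : ModelWithCorners ℝ E H}
  {M : Type*} [TopologicalSpace M] [ChartedSpace H M]

theorem contMDiffOn_of_eventuallyEq {f : M → ℝ} {U : Set M}
    (h : ∀ y ∈ U, ∃ g : C^∞⟮I, M; ℝ⟯, f =ᶠ[𝓝 y] g) : ContMDiffOn I 𝓘(ℝ) ∞ f U := by
  intro y hy
  obtain ⟨g, hg⟩ := h y hy
  exact (g.contMDiff.contMDiffAt.congr_of_eventuallyEq hg).contMDiffWithinAt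

variable [IsManifold I ∞ M]

variable (I M) in
/-- The differential as a linear map. -/
def differentialLinear : C^∞⟮I, M; ℝ⟯ →ₗ[ℝ] OneForm I M where
  toFun := differential
  map_add' := differential_add
  map_smul' := differential_const_smul

theorem LocalFrame.exists_mvfderiv_eq {ι : Type*} [Fintype ι] {y x : M} (F : LocalFrame I ι y)
    (hx : F.cutoff x = 1) (γ : TangentSpace I x →L[ℝ] ℝ) :
    ∃ f : C^∞⟮I, M; ℝ⟯, mvfderiv I f x = γ := by
  refine ⟨∑ i, γ (F.frame i x) • F.coord i, ?_⟩
  have h := map_sum (differentialLinear I M) (fun i => γ (F.frame i x) • F.coord i) Finset.univ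
  simp only [map_smul] at h
  have h' := congrArg (fun α : OneForm I M => α x) h
  refine h'.trans ?_
  rw [section_sum_apply]
  exact (F.covector_eq_sum hx γ).symm

/-- The smooth function `Q(α, β)` for two `1`-forms. -/
def ContraTwo.pair (Q : ContraTwo I M) (α β : OneForm I M) : C^∞⟮I, M; ℝ⟯ :=
  ⟨fun x => Q.form x (α x) (β x), by
    intro x
    have h1 := ContMDiffAt.clm_bundle_apply (Q.contMDiff x) (α.contMDiff x)
    have h2 := ContMDiffAt.clm_bundle_apply (E₂ := Bundle.Trivial M ℝ) (F₂ := ℝ)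
      (β.contMDiff x) h1
    rw [contMDiffAt_section] at h2
    exact h2⟩

namespace ContravariantConnection

variable {w : BivectorField I M} (D : ContravariantConnection w)

/-- A contravariant connection as a linear map in the `1`-form. -/
def leftHom (X : VectorField I M) : OneForm I M →ₗ[C^∞⟮I, M; ℝ⟯] VectorField I M where
  toFun α := D.toFun α X
  map_add' α β := D.add_left α β X
  map_smul' f α := D.smul_left f α X

/-- A contravariant connection as an additive map in the vector field. -/
def rightHom (α : OneForm I M) : VectorField I M →+ VectorField I M :=
  AddMonoidHom.mk' (D.toFun α) (D.add_right α)

/-- Linearity over functions in the `1`-form allows the cutoff expansion of `α` to be pulled through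
`D`; at `x` the cutoff is `1`. -/
theorem apply_eq_sum {ι : Type*} [Fintype ι] {y x : M} (F : LocalFrame I ι y)
    (hx : F.cutoff x = 1) (α : OneForm I M) (X : VectorField I M) :
    D.toFun α X x = ∑ i, α x (F.frame i x) • D.toFun (differential (F.coord i)) X x := by
  have h1 : F.cutoff • D.toFun α X =
      ∑ i, contract α (F.frame i) • D.toFun (differential (F.coord i)) X := by
    have h := map_sum (D.leftHom X)
      (fun i => contract α (F.frame i) • differential (F.coord i)) Finset.univ
    rw [← F.cutoff_smul_oneForm α] at h
    simp only [map_smul] at h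
    exact h
  have h2 := congrArg (fun Y : VectorField I M => Y x) h1
  simp only [section_sum_apply, section_smul_apply, hx, one_smul] at h2
  exact h2

end ContravariantConnection

end General

/-! ### The bracket relations determine `W` and make it a lift. -/

section Cotangent

variable {n : ℕ} {M : Type*} [TopologicalSpace M] [ChartedSpace (EuclideanSpace ℝ (Fin n)) M]
  [IsManifold (𝓡 n) ∞ M]
  {w : BivectorField (𝓡 n) M}

theorem exists_localFrame_self [T2Space M] (x : M) :
    ∃ F : LocalFrame (𝓡 n) (Fin n) x, F.Extends x x :=
  exists_localFrame_extends (mem_extChartAt_source x)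

theorem exists_mvfderiv_eq [T2Space M] {x : M} (γ : TangentSpace (𝓡 n) x →L[ℝ] ℝ) :
    ∃ f : C^∞⟮𝓡 n, M; ℝ⟯, mvfderiv (𝓡 n) f x = γ := by
  obtain ⟨F, -⟩ := exists_localFrame_self (n := n) x
  exact F.exists_mvfderiv_eq F.cutoff_eq_one γ

/-- The bracket relations involve `D` on exact forms only. This loses nothing, because the
differentials of frame coordinates span the covectors at each point. -/
theorem ContravariantConnection.ext_differential [T2Space M] {D D' : ContravariantConnection w}
    (h : ∀ (f : C^∞⟮𝓡 n, M; ℝ⟯) X, D.toFun (differential f) X = D'.toFun (differential f) X) :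
    D = D' := by
  have h' : D.toFun = D'.toFun := by
    funext α X
    ext1 x
    obtain ⟨F, -⟩ := exists_localFrame_self (n := n) x
    rw [D.apply_eq_sum F F.cutoff_eq_one, D'.apply_eq_sum F F.cutoff_eq_one]
    simp only [h]
  cases D; cases D'
  cases h'
  rfl

variable {W W' : CotangentBivector n M} {D : ContravariantConnection w}
  {Ψ : VectorField (𝓡 n) M → VectorField (𝓡 n) M → SymTwo (𝓡 n) M}

theorem IsDefinedBy.mixed' (h : IsDefinedBy W D Ψ) (X : VectorField (𝓡 n) M)
    (f : C^∞⟮𝓡 n, M; ℝ⟯) :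
    W.bracket (f ∘ proj) (momentum X) = momentum (D.toFun (differential f) X) := by
  rw [W.bracket_skew, h.mixed, neg_neg]

theorem eq_of_bracket_cotangentCoord [T2Space M]
    (h : ∀ (x : M) (F : LocalFrame (𝓡 n) (Fin n) x) (a b : Fin n ⊕ Fin n),
      W.bracket (F.cotangentCoord a) (F.cotangentCoord b) =
        W'.bracket (F.cotangentCoord a) (F.cotangentCoord b)) : W = W' := by
  refine BivectorField.ext_form fun z θ η => ?_
  obtain ⟨F, hF⟩ := exists_localFrame_self (n := n) (proj z)
  obtain ⟨c, rfl⟩ := covector_eq_sum_cotangentCoord hF θ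
  obtain ⟨d, rfl⟩ := covector_eq_sum_cotangentCoord hF η
  simp only [map_sum, map_smul, LinearMap.sum_apply, LinearMap.smul_apply,
    ← BivectorField.bracket_eq_form, h]

/-- A bivector field is determined by the brackets of functions on the base and of momenta. -/
theorem IsDefinedBy.unique [T2Space M] (h : IsDefinedBy W D Ψ) (h' : IsDefinedBy W' D Ψ) : W = W' := by
  refine eq_of_bracket_cotangentCoord fun x F a b => ?_
  rcases a with i | i <;> rcases b with j | j
  · exact (h.base _ _).trans (h'.base _ _).symm
  · exact (h.mixed' _ _).trans (h'.mixed' _ _).symm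
  · exact (h.mixed _ _).trans (h'.mixed _ _).symm
  · exact (h.momenta _ _).trans (h'.momenta _ _).symm

/-- The function on the base is the restriction to the zero section. -/
theorem IsFoliated.exists_pullback {K : C^∞⟮cotangentModel n, CotangentBundle n M; ℝ⟯}
    (hK : IsFoliated K) : ∃ f : C^∞⟮𝓡 n, M; ℝ⟯, (K : CotangentBundle n M → ℝ) = f ∘ proj := by
  refine ⟨⟨K ∘ zeroSection _ _, K.contMDiff.comp (contMDiff_zeroSection ℝ _)⟩, ?_⟩
  funext z
  exact hK _ _ rfl

theorem IsDefinedBy.isSemiPoisson (h : IsDefinedBy W D Ψ) (hw : w.IsPoisson) :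
    IsSemiPoisson W := by
  refine ⟨fun K L hK hL => ?_, fun K L N hK hL hN => ?_⟩
  · obtain ⟨f, hf⟩ := hK.exists_pullback
    obtain ⟨g, hg⟩ := hL.exists_pullback
    rw [hf, hg, h.base]
    intro z z' hz
    exact congrArg (w.bracket f g) hz
  · obtain ⟨f, hf⟩ := hK.exists_pullback
    obtain ⟨g, hg⟩ := hL.exists_pullback
    obtain ⟨k, hk⟩ := hN.exists_pullback
    have h2 : ∀ a b c : C^∞⟮𝓡 n, M; ℝ⟯, W.bracket (a ∘ proj) (W.bracket (b ∘ proj) (c ∘ proj)) =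
        w.bracket a (w.bracket b c) ∘ proj := by
      intro a b c
      rw [h.base, w.bracket_smooth b c, h.base]
    rw [hf, hg, hk, h2, h2, h2]
    funext z
    exact congrFun (hw f g k) (proj z)

/-- Relatedness is a condition on single covectors, and each covector is the differential of a
global function. -/
theorem IsDefinedBy.isProjRelated [T2Space M] (h : IsDefinedBy W D Ψ) : IsProjRelated W w := by
  intro z α β
  obtain ⟨f, rfl⟩ := exists_mvfderiv_eq α
  obtain ⟨g, rfl⟩ := exists_mvfderiv_eq β
  rw [← mvfderiv_pullback, ← mvfderiv_pullback]
  exact congrFun (h.base f g) z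

theorem momentum_eq_sum {x y : M} (F : LocalFrame (𝓡 n) (Fin n) y) (hx : F.cutoff x = 1)
    (X : VectorField (𝓡 n) M) (α : TangentSpace (𝓡 n) x →L[ℝ] ℝ) :
    momentum X ⟨x, α⟩ = ∑ a, momentum (F.frame a) ⟨x, α⟩ * mvfderiv (𝓡 n) (F.coord a) x (X x) := by
  rw [momentum_apply]
  simp only
  conv_lhs => rw [F.covector_eq_sum hx α]
  simp only [_root_.sum_apply, _root_.smul_apply, smul_eq_mul]
  rfl

theorem quadratic_eq_sum {x y : M} (F : LocalFrame (𝓡 n) (Fin n) y) (hx : F.cutoff x = 1)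
    (Q : SymTwo (𝓡 n) M) (α : TangentSpace (𝓡 n) x →L[ℝ] ℝ) :
    quadratic Q ⟨x, α⟩ = ∑ a, ∑ b, momentum (F.frame a) ⟨x, α⟩ * momentum (F.frame b) ⟨x, α⟩ *
      (Q : ContraTwo (𝓡 n) M).form x (mvfderiv (𝓡 n) (F.coord a) x)
        (mvfderiv (𝓡 n) (F.coord b) x) := by
  rw [quadratic_apply]
  simp only
  conv_lhs => rw [F.covector_eq_sum hx α]
  simp only [map_sum, map_smul, LinearMap.sum_apply, LinearMap.smul_apply, smul_eq_mul,
    momentum_apply]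
  rw [Finset.sum_comm]
  simp only [Finset.mul_sum]
  refine Finset.sum_congr rfl fun a _ => Finset.sum_congr rfl fun b _ => ?_
  ring

theorem quadratic_polarization (Q : SymTwo (𝓡 n) M) {x : M}
    (α β : TangentSpace (𝓡 n) x →L[ℝ] ℝ) :
    (1 / 2 : ℝ) * (quadratic Q ⟨x, α + β⟩ - quadratic Q ⟨x, α⟩ - quadratic Q ⟨x, β⟩) =
      (Q : ContraTwo (𝓡 n) M).form x α β := by
  simp only [quadratic_apply, map_add, LinearMap.add_apply]
  rw [SymTwo.form_symm Q x β α]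
  ring

theorem IsDefinedBy.bracket_coord (h : IsDefinedBy W D Ψ) {x₀ y : M} {z : CotangentBundle n M}
    {F : LocalFrame (𝓡 n) (Fin n) y} (hF : F.Extends x₀ (proj z)) (i j : Fin n) :
    W.bracket (coordX x₀ i) (coordX x₀ j) z = w.bracket (F.coord i) (F.coord j) (proj z) ∧
    W.bracket (coordX x₀ i) (coordP x₀ j) z =
      momentum (D.toFun (differential (F.coord i)) (F.frame j)) z ∧
    W.bracket (coordP x₀ i) (coordP x₀ j) z = quadratic (Ψ (F.frame i) (F.frame j)) z := by
  refine ⟨?_, ?_, ?_⟩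
  · rw [W.bracket_congr (hF.coordX_eq i) (hF.coordX_eq j), h.base]
    rfl
  · rw [W.bracket_congr (hF.coordX_eq i) (hF.coordP_eq j), h.mixed']
  · rw [W.bracket_congr (hF.coordP_eq i) (hF.coordP_eq j), h.momenta]

theorem IsDefinedBy.isGraded [T2Space M] (h : IsDefinedBy W D Ψ) : IsGraded W := by
  intro x₀
  let dx : Fin n → ∀ x : M, TangentSpace (𝓡 n) x →L[ℝ] ℝ :=
    fun a => mvfderiv (𝓡 n) fun x => extChartAt (𝓡 n) x₀ x a
  have hdx : ∀ {y y' : M} {F : LocalFrame (𝓡 n) (Fin n) y}, F.Extends x₀ y' → ∀ a,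
      dx a y' = mvfderiv (𝓡 n) (F.coord a) y' := fun hF a =>
    (mvfderiv_congr (hF.coord_eq a)).symm
  let q : Fin n → Fin n → ∀ x : M, (TangentSpace (𝓡 n) x →L[ℝ] ℝ) → ℝ := fun i j x α =>
    W.bracket (coordP x₀ i) (coordP x₀ j) ⟨x, α⟩
  -- The coefficients need one formula on the whole chart domain, whereas a frame agrees with the
  -- chart only near a point. They are therefore read off from `W` itself: at the zero covector, at
  -- `dxᵃ`, and by polarization at `dxᵃ` and `dxᵇ`. Frames serve only to verify smoothness and the
  -- expansion locally.
  refine ⟨fun i j x => W.bracket (coordX x₀ i) (coordX x₀ j) ⟨x, 0⟩,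
    fun i a j x => W.bracket (coordX x₀ i) (coordP x₀ j) ⟨x, dx a x⟩,
    fun a b i j x => (1 / 2 : ℝ) * (q i j x (dx a x + dx b x) - q i j x (dx a x) - q i j x (dx b x)),
    fun i j => contMDiffOn_of_eventuallyEq fun y hy => ?_,
    fun i a j => contMDiffOn_of_eventuallyEq fun y hy => ?_,
    fun a b i j => contMDiffOn_of_eventuallyEq fun y hy => ?_, fun z hz i j => ?_⟩
  · obtain ⟨F, hF⟩ := exists_localFrame_extends hy
    refine ⟨w.pair (differential (F.coord i)) (differential (F.coord j)), ?_⟩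
    filter_upwards [hF.eventually] with x hx
    exact (h.bracket_coord (z := ⟨x, 0⟩) hx i j).1
  · obtain ⟨F, hF⟩ := exists_localFrame_extends hy
    refine ⟨F.comp (D.toFun (differential (F.coord i)) (F.frame j)) a, ?_⟩
    filter_upwards [hF.eventually] with x hx
    rw [hdx hx]
    exact (h.bracket_coord (z := ⟨x, mvfderiv (𝓡 n) (F.coord a) x⟩) hx i j).2.1
  · obtain ⟨F, hF⟩ := exists_localFrame_extends hy
    refine ⟨(Ψ (F.frame i) (F.frame j) : ContraTwo (𝓡 n) M).pair (differential (F.coord a))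
      (differential (F.coord b)), ?_⟩
    filter_upwards [hF.eventually] with x hx
    have hq : ∀ α, q i j x α = quadratic (Ψ (F.frame i) (F.frame j)) ⟨x, α⟩ := fun α =>
      (h.bracket_coord (z := ⟨x, α⟩) hx i j).2.2
    rw [hq, hq, hq, quadratic_polarization, hdx hx, hdx hx]
    rfl
  · obtain ⟨F, hF⟩ := exists_localFrame_extends hz
    obtain ⟨x, α⟩ := z
    have hP : ∀ a, coordP x₀ a ⟨x, α⟩ = momentum (F.frame a) ⟨x, α⟩ := fun a =>
      (hF.coordP_eq (z := ⟨x, α⟩) a).eq_of_nhds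
    have hx : F.Extends x₀ x := hF
    have hb := fun z hz => h.bracket_coord (z := z) (F := F) (x₀ := x₀) hz i j
    have hρ : F.cutoff x = 1 := F.cutoff_eq_one
    refine ⟨?_, ?_, ?_⟩
    · exact (hb ⟨x, α⟩ hx).1.trans (hb ⟨x, 0⟩ hx).1.symm
    · rw [(hb ⟨x, α⟩ hx).2.1, momentum_eq_sum F hρ]
      refine Finset.sum_congr rfl fun a _ => ?_
      rw [hP]
      refine congrArg _ (Eq.trans ?_ (hb ⟨x, dx a x⟩ hx).2.1.symm)
      rw [hdx hx]
      rfl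
    · rw [(hb ⟨x, α⟩ hx).2.2, quadratic_eq_sum F hρ]
      refine Finset.sum_congr rfl fun a _ => Finset.sum_congr rfl fun b _ => ?_
      have hq : ∀ β, q i j x β = quadratic (Ψ (F.frame i) (F.frame j)) ⟨x, β⟩ := fun β =>
        (hb ⟨x, β⟩ hx).2.2
      rw [hP, hP]
      refine congrArg _ ?_
      change _ = (1 / 2 : ℝ) * (q i j x (dx a x + dx b x) - q i j x (dx a x) - q i j x (dx b x))
      rw [hq, hq, hq, quadratic_polarization, hdx hx, hdx hx]

theorem IsDefinedBy.isLift [T2Space M] (h : IsDefinedBy W D Ψ) (hw : w.IsPoisson) :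
    IsGradedSemiPoissonLift w W :=
  ⟨h.isGraded, h.isSemiPoisson hw, h.isProjRelated⟩

end Cotangent

/-! ### The connection and the operator of a lift. -/

section Construction

variable {n : ℕ} {M : Type*} [TopologicalSpace M] [ChartedSpace (EuclideanSpace ℝ (Fin n)) M]
  [IsManifold (𝓡 n) ∞ M] {w : BivectorField (𝓡 n) M}

/-- A function which is locally the momentum of a vector field is a momentum. -/
theorem exists_momentum_eq {K : CotangentBundle n M → ℝ}
    (h : ∀ y : M, ∃ X : VectorField (𝓡 n) M, ∀ᶠ x in 𝓝 y, ∀ α : TangentSpace (𝓡 n) x →L[ℝ] ℝ,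
      K ⟨x, α⟩ = momentum X ⟨x, α⟩) : ∃ X : VectorField (𝓡 n) M, momentum X = K := by
  choose X hX using h
  -- The value at `x` is taken from the field chosen at `x`. Near `y` it agrees with the single
  -- field `X y`, because covectors separate vectors.
  refine ⟨⟨fun x => X x x, fun y => ?_⟩, ?_⟩
  · refine ((X y).contMDiff y).congr_of_eventuallyEq ?_
    filter_upwards [hX y] with x hx
    refine congrArg _ (eq_of_forall_covector fun α => ?_)
    exact ((hX x).self_of_nhds α).symm.trans (hx α)
  · funext z
    exact ((hX z.1).self_of_nhds z.2).symm

/-- A function which is locally the quadratic polynomial of a symmetric tensor field is the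
quadratic polynomial of a symmetric tensor field. -/
theorem exists_quadratic_eq {K : CotangentBundle n M → ℝ}
    (h : ∀ y : M, ∃ Q : SymTwo (𝓡 n) M, ∀ᶠ x in 𝓝 y, ∀ α : TangentSpace (𝓡 n) x →L[ℝ] ℝ,
      K ⟨x, α⟩ = quadratic Q ⟨x, α⟩) : ∃ Q : SymTwo (𝓡 n) M, quadratic Q = K := by
  choose Q hQ using h
  refine ⟨⟨⟨fun x => (Q x : ContraTwo (𝓡 n) M) x, fun y => ?_⟩, fun x α β => (Q x).2 x α β⟩, ?_⟩
  · refine ((Q y : ContraTwo (𝓡 n) M).contMDiff y).congr_of_eventuallyEq ?_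
    filter_upwards [hQ y] with x hx
    have hq : ∀ α, quadratic (Q x) ⟨x, α⟩ = quadratic (Q y) ⟨x, α⟩ := fun α =>
      ((hQ x).self_of_nhds α).symm.trans (hx α)
    refine congrArg _ (ContinuousLinearMap.ext fun α => eq_of_forall_covector fun β => ?_)
    change (Q x : ContraTwo (𝓡 n) M).form x α β = (Q y : ContraTwo (𝓡 n) M).form x α β
    rw [← quadratic_polarization, ← quadratic_polarization, hq, hq, hq]
  · funext z
    exact ((hQ z.1).self_of_nhds z.2).symm

section Expansion

variable {ι : Type*} [Fintype ι] {y : M} (F : LocalFrame (𝓡 n) ι y)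

theorem LocalFrame.eventually_cutoff : ∀ᶠ x in 𝓝 y, (F.cutoff : M → ℝ) =ᶠ[𝓝 x] 1 :=
  eventually_eventually_nhds.2 F.cutoff_eq

theorem LocalFrame.momentum_eventuallyEq {z : CotangentBundle n M}
    (hz : (F.cutoff : M → ℝ) =ᶠ[𝓝 (proj z)] 1) (X : VectorField (𝓡 n) M) :
    momentum X =ᶠ[𝓝 z] ∑ j, (F.comp X j ∘ proj) * momentum (F.frame j) := by
  have h := congrArg momentum (F.cutoff_smul_vectorField X)
  rw [momentum_smul, momentum_sum] at h
  filter_upwards [eventually_proj hz] with z' hz'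
  have h' := congrFun h z'
  simp only [Pi.mul_apply, Function.comp_apply, hz', Pi.one_apply, one_mul] at h'
  rw [h']
  simp only [momentum_smul]

/-- This is `d m(X) = ∑ (Xʲ d m(e_j) + m(e_j) dXʲ)`, which reduces every bracket with `m(X)` to
brackets of frame momenta and of functions on the base. -/
theorem LocalFrame.mvfderiv_momentum {z : CotangentBundle n M}
    (hz : (F.cutoff : M → ℝ) =ᶠ[𝓝 (proj z)] 1) (X : VectorField (𝓡 n) M) :
    mvfderiv (cotangentModel n) (momentum X) z =
      ∑ j, (F.comp X j (proj z) • mvfderiv (cotangentModel n) (momentum (F.frame j)) z +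
        momentum (F.frame j) z • mvfderiv (cotangentModel n) (F.comp X j ∘ proj) z) := by
  rw [mvfderiv_congr (F.momentum_eventuallyEq hz X), mvfderiv_sum]
  · refine Finset.sum_congr rfl fun j _ => ?_
    rw [mvfderiv_mul (mdifferentiableAt_pullback _ z) (mdifferentiableAt_momentum _ z)]
    rfl
  · exact fun j _ => (mdifferentiableAt_pullback _ z).mul (mdifferentiableAt_momentum _ z)

end Expansion

section Lift

variable {W : CotangentBivector n M}

/-- The value of a bivector field of `T*M` on `d m(X)` and on the pullback of a `1`-form. -/
def mixedValue (W : CotangentBivector n M) (α : OneForm (𝓡 n) M) (X : VectorField (𝓡 n) M)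
    (z : CotangentBundle n M) : ℝ :=
  W.tensor.form z (mvfderiv (cotangentModel n) (momentum X) z)
    ((α (proj z)).comp (mfderiv (cotangentModel n) (𝓡 n) proj z))

/-- `mixedValue` extends the mixed bracket from exact forms to all `1`-forms, so that `D` can be
defined on all of them at once, without coordinates. -/
theorem mixedValue_differential (f : C^∞⟮𝓡 n, M; ℝ⟯) (X : VectorField (𝓡 n) M)
    (z : CotangentBundle n M) :
    mixedValue W (differential f) X z = W.bracket (momentum X) (f ∘ proj) z := by
  rw [BivectorField.bracket_eq_form, mvfderiv_pullback]
  rfl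

theorem IsProjRelated.form_pullback (h : IsProjRelated W w) (f : C^∞⟮𝓡 n, M; ℝ⟯)
    (α : OneForm (𝓡 n) M) (z : CotangentBundle n M) :
    W.tensor.form z (mvfderiv (cotangentModel n) (f ∘ proj) z)
      ((α (proj z)).comp (mfderiv (cotangentModel n) (𝓡 n) proj z)) =
      w.pair (differential f) α (proj z) := by
  rw [mvfderiv_pullback]
  exact h z _ _

theorem mixedValue_add_left (α β : OneForm (𝓡 n) M) (X : VectorField (𝓡 n) M) :
    mixedValue W (α + β) X = mixedValue W α X + mixedValue W β X := by
  funext z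
  simp only [mixedValue, Pi.add_apply]
  rw [← map_add]
  rfl

theorem mixedValue_smul_left (f : C^∞⟮𝓡 n, M; ℝ⟯) (α : OneForm (𝓡 n) M)
    (X : VectorField (𝓡 n) M) :
    mixedValue W (f • α) X = (f ∘ proj) * mixedValue W α X := by
  funext z
  simp only [mixedValue, Pi.mul_apply, Function.comp_apply]
  rw [← smul_eq_mul, ← map_smul]
  rfl

theorem mixedValue_add_right (α : OneForm (𝓡 n) M) (X Y : VectorField (𝓡 n) M) :
    mixedValue W α (X + Y) = mixedValue W α X + mixedValue W α Y := by
  funext z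
  simp only [mixedValue, momentum_add, Pi.add_apply]
  rw [mvfderiv_add (mdifferentiableAt_momentum X z) (mdifferentiableAt_momentum Y z), map_add,
    LinearMap.add_apply]

/-- The product rule for `f m(X)` yields a term in which `W` meets two pulled back covectors.
Relatedness turns it into `w`, and skewness gives the sign. Up to sign this is the Leibniz rule of
`D`. -/
theorem mixedValue_smul_right (h : IsProjRelated W w) (α : OneForm (𝓡 n) M)
    (f : C^∞⟮𝓡 n, M; ℝ⟯) (X : VectorField (𝓡 n) M) :
    mixedValue W α (f • X) =
      (f ∘ proj) * mixedValue W α X - (w.pair α (differential f) ∘ proj) * momentum X := by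
  funext z
  simp only [mixedValue, momentum_smul, Pi.sub_apply, Pi.mul_apply]
  rw [mvfderiv_mul (mdifferentiableAt_pullback f z) (mdifferentiableAt_momentum X z)]
  simp only [map_add, map_smul, LinearMap.add_apply, LinearMap.smul_apply, smul_eq_mul]
  rw [h.form_pullback, BivectorField.pair_apply, w.form_skew, ← BivectorField.pair_apply]
  simp only [Function.comp_apply]
  ring

/-- Only the brackets of frame momenta with coordinates remain unknown here, and gradedness controls
those. -/
theorem mixedValue_eq_sum (h : IsProjRelated W w) {y : M} (F : LocalFrame (𝓡 n) (Fin n) y)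
    {z : CotangentBundle n M} (hz : (F.cutoff : M → ℝ) =ᶠ[𝓝 (proj z)] 1)
    (α : OneForm (𝓡 n) M) (X : VectorField (𝓡 n) M) :
    mixedValue W α X z =
      ∑ j, (F.comp X j (proj z) * ∑ i, contract α (F.frame i) (proj z) *
          W.bracket (momentum (F.frame j)) (F.coord i ∘ proj) z +
        momentum (F.frame j) z * w.pair (differential (F.comp X j)) α (proj z)) := by
  rw [mixedValue, F.mvfderiv_momentum hz, map_sum, LinearMap.sum_apply]
  refine Finset.sum_congr rfl fun j _ => ?_
  simp only [map_add, map_smul, LinearMap.add_apply, LinearMap.smul_apply, smul_eq_mul]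
  rw [h.form_pullback]
  congr 2
  have hα : (α (proj z)).comp (mfderiv (cotangentModel n) (𝓡 n) proj z) =
      ∑ i, contract α (F.frame i) (proj z) •
        mvfderiv (cotangentModel n) (F.coord i ∘ proj) z := by
    simp only [mvfderiv_pullback]
    refine ContinuousLinearMap.ext fun v => ?_
    have h1 := DFunLike.congr_fun (F.covector_eq_sum hz.eq_of_nhds (α (proj z)))
      (mfderiv (cotangentModel n) (𝓡 n) proj z v)
    simp only [_root_.sum_apply, _root_.smul_apply] at h1 ⊢
    exact h1
  rw [hα]
  simp only [map_sum, map_smul, smul_eq_mul]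
  rfl

/-- The local form of a graded bivector field, in terms of global objects. -/
theorem IsGraded.exists_local [T2Space M] (h : IsGraded W) {y : M}
    {F : LocalFrame (𝓡 n) (Fin n) y} (hF : F.Extends y y) :
    ∃ (V : Fin n → Fin n → VectorField (𝓡 n) M) (Q : Fin n → Fin n → SymTwo (𝓡 n) M),
      ∀ᶠ x in 𝓝 y, ∀ (α : TangentSpace (𝓡 n) x →L[ℝ] ℝ) (i j : Fin n),
        W.bracket (momentum (F.frame j)) (F.coord i ∘ proj) ⟨x, α⟩ = momentum (V j i) ⟨x, α⟩ ∧
        W.bracket (momentum (F.frame i)) (momentum (F.frame j)) ⟨x, α⟩ =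
          quadratic (Q i j) ⟨x, α⟩ := by
  obtain ⟨c, A, C, -, hA, hC, hW⟩ := h y
  have hy := mem_extChartAt_source (I := 𝓡 n) y
  have hU := isOpen_extChartAt_source (I := 𝓡 n) y
  choose A' hA' using fun i a j => exists_function_extension hU (hA i a j) hy
  choose C' hC' using fun a b i j => exists_function_extension hU (hC a b i j) hy
  -- The sign arises because gradedness prescribes `{xⁱ, p_j}`, while `{p_j, xⁱ}` is wanted. The
  -- coefficients `C` need not be symmetric in `a, b`; the symmetric product retains the only part
  -- that the polynomial sees.
  refine ⟨fun j i => -∑ a, A' i a j • F.frame a,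
    fun i j => ∑ a, ∑ b, C' a b i j • symProd (F.frame a) (F.frame b), ?_⟩
  filter_upwards [hF.eventually, hU.mem_nhds hy,
    Filter.eventually_all.2 fun i => Filter.eventually_all.2 fun a =>
      Filter.eventually_all.2 fun j => hA' i a j,
    Filter.eventually_all.2 fun a => Filter.eventually_all.2 fun b =>
      Filter.eventually_all.2 fun i => Filter.eventually_all.2 fun j => hC' a b i j]
    with x hx hxU hAx hCx α i j
  have hP : ∀ a, coordP y a =ᶠ[𝓝 (⟨x, α⟩ : CotangentBundle n M)] momentum (F.frame a) := fun a =>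
    LocalFrame.Extends.coordP_eq (z := ⟨x, α⟩) hx a
  have hX : ∀ a, coordX y a =ᶠ[𝓝 (⟨x, α⟩ : CotangentBundle n M)] F.coord a ∘ proj := fun a =>
    LocalFrame.Extends.coordX_eq (z := ⟨x, α⟩) hx a
  obtain ⟨-, h1, -⟩ := hW ⟨x, α⟩ hxU i j
  obtain ⟨-, -, h2⟩ := hW ⟨x, α⟩ hxU i j
  rw [W.bracket_congr (hX i) (hP j)] at h1
  rw [W.bracket_congr (hP i) (hP j)] at h2
  constructor
  · rw [W.bracket_skew, Pi.neg_apply, h1, momentum_neg, Pi.neg_apply, momentum_sum,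
      Finset.sum_apply]
    refine congrArg _ (Finset.sum_congr rfl fun a _ => ?_)
    rw [momentum_smul, (hP a).eq_of_nhds, Pi.mul_apply, mul_comm]
    exact congrArg (· * _) (hAx i a j).symm
  · rw [h2, quadratic_sum, Finset.sum_apply]
    refine Finset.sum_congr rfl fun a _ => ?_
    rw [quadratic_sum, Finset.sum_apply]
    refine Finset.sum_congr rfl fun b _ => ?_
    rw [quadratic_smul, quadratic_symProd, (hP a).eq_of_nhds, (hP b).eq_of_nhds, Pi.mul_apply,
      Pi.mul_apply, mul_comm]
    exact congrArg (· * _) (hCx a b i j).symm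

theorem exists_momentum_eq_mixedValue [T2Space M] (hg : IsGraded W) (hr : IsProjRelated W w)
    (α : OneForm (𝓡 n) M) (X : VectorField (𝓡 n) M) :
    ∃ Y : VectorField (𝓡 n) M, momentum Y = -mixedValue W α X := by
  refine exists_momentum_eq fun y => ?_
  obtain ⟨F, hF⟩ := exists_localFrame_self (n := n) y
  obtain ⟨V, Q, hV⟩ := hg.exists_local hF
  refine ⟨-∑ j, (F.comp X j • (∑ i, contract α (F.frame i) • V j i) +
    w.pair (differential (F.comp X j)) α • F.frame j), ?_⟩
  filter_upwards [hV, F.eventually_cutoff] with x hVx hx β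
  rw [Pi.neg_apply, mixedValue_eq_sum hr F (z := ⟨x, β⟩) hx, momentum_neg, Pi.neg_apply,
    momentum_sum, Finset.sum_apply]
  refine congrArg _ (Finset.sum_congr rfl fun j _ => ?_)
  simp only [momentum_add, momentum_smul, momentum_sum, Pi.add_apply, Pi.mul_apply,
    Finset.sum_apply, hVx, Function.comp_apply]
  ring

/-- The contravariant connection of a graded bivector field related with `w`. -/
theorem exists_connection [T2Space M] (hg : IsGraded W) (hr : IsProjRelated W w) :
    ∃ D : ContravariantConnection w, ∀ α X, momentum (D.toFun α X) = -mixedValue W α X := by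
  choose D hD using exists_momentum_eq_mixedValue hg hr
  refine ⟨⟨D, fun α β X => momentum_injective ?_, fun f α X => momentum_injective ?_,
    fun α X Y => momentum_injective ?_, fun α f X => momentum_injective ?_⟩, hD⟩
  · rw [momentum_add, hD, hD, hD, mixedValue_add_left, neg_add]
  · rw [momentum_smul, hD, hD, mixedValue_smul_left, mul_neg]
  · rw [momentum_add, hD, hD, hD, mixedValue_add_right, neg_add]
  · rw [momentum_add, momentum_smul, momentum_smul, hD, hD, mixedValue_smul_right hr]
    ring

theorem bracket_momentum_left {ι : Type*} [Fintype ι] {y : M} (F : LocalFrame (𝓡 n) ι y)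
    {z : CotangentBundle n M} (hz : (F.cutoff : M → ℝ) =ᶠ[𝓝 (proj z)] 1)
    (X : VectorField (𝓡 n) M) (G : CotangentBundle n M → ℝ) :
    W.bracket (momentum X) G z = ∑ j, (F.comp X j (proj z) * W.bracket (momentum (F.frame j)) G z +
      momentum (F.frame j) z * W.bracket (F.comp X j ∘ proj) G z) := by
  rw [BivectorField.bracket_eq_form, F.mvfderiv_momentum hz X, map_sum, LinearMap.sum_apply]
  refine Finset.sum_congr rfl fun j _ => ?_
  rw [map_add, map_smul, map_smul]
  rfl

theorem bracket_momentum_right {ι : Type*} [Fintype ι] {y : M} (F : LocalFrame (𝓡 n) ι y)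
    {z : CotangentBundle n M} (hz : (F.cutoff : M → ℝ) =ᶠ[𝓝 (proj z)] 1)
    (G : CotangentBundle n M → ℝ) (X : VectorField (𝓡 n) M) :
    W.bracket G (momentum X) z = ∑ j, (F.comp X j (proj z) * W.bracket G (momentum (F.frame j)) z +
      momentum (F.frame j) z * W.bracket G (F.comp X j ∘ proj) z) := by
  rw [W.bracket_skew, Pi.neg_apply, bracket_momentum_left F hz, ← Finset.sum_neg_distrib]
  refine Finset.sum_congr rfl fun j _ => ?_
  rw [W.bracket_skew G, W.bracket_skew G, Pi.neg_apply, Pi.neg_apply]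
  ring

/-- Both momenta are expanded in a frame. The brackets of frame momenta are quadratic by gradedness.
Each other term is a momentum times a mixed bracket, which `hD` makes a momentum, so it is a product
of two momenta. -/
theorem exists_quadratic_eq_bracket [T2Space M] (hg : IsGraded W) {D : ContravariantConnection w}
    (hD : ∀ (X : VectorField (𝓡 n) M) (f : C^∞⟮𝓡 n, M; ℝ⟯),
      W.bracket (momentum X) (f ∘ proj) = -momentum (D.toFun (differential f) X))
    (X Y : VectorField (𝓡 n) M) :
    ∃ Q : SymTwo (𝓡 n) M, quadratic Q = W.bracket (momentum X) (momentum Y) := by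
  refine exists_quadratic_eq fun y => ?_
  obtain ⟨F, hF⟩ := exists_localFrame_self (n := n) y
  obtain ⟨V, Q, hV⟩ := hg.exists_local hF
  refine ⟨∑ i, (F.comp X i • (∑ j, (F.comp Y j • Q i j -
    symProd (F.frame j) (D.toFun (differential (F.comp Y j)) (F.frame i)))) +
    symProd (F.frame i) (D.toFun (differential (F.comp X i)) Y)), ?_⟩
  filter_upwards [hV, F.eventually_cutoff] with x hVx hx β
  rw [bracket_momentum_left F (z := ⟨x, β⟩) hx, quadratic_sum, Finset.sum_apply]
  refine Finset.sum_congr rfl fun i _ => ?_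
  rw [bracket_momentum_right F (z := ⟨x, β⟩) hx, W.bracket_skew, hD, neg_neg, quadratic_add,
    quadratic_smul, quadratic_sum, quadratic_symProd, Pi.add_apply, Pi.mul_apply, Pi.mul_apply,
    Finset.sum_apply]
  refine congrArg₂ _ (congrArg₂ _ rfl (Finset.sum_congr rfl fun j _ => ?_)) rfl
  rw [(hVx β i j).2, hD, quadratic_sub, quadratic_smul, quadratic_symProd, Pi.sub_apply,
    Pi.mul_apply, Pi.mul_apply, Pi.neg_apply, mul_neg, ← sub_eq_add_neg]
  rfl

/-- Every lift is defined by a contravariant connection and an operator. -/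
theorem IsGradedSemiPoissonLift.exists_isDefinedBy [T2Space M]
    (h : IsGradedSemiPoissonLift w W) :
    ∃ (D : ContravariantConnection w)
      (Ψ : VectorField (𝓡 n) M → VectorField (𝓡 n) M → SymTwo (𝓡 n) M), IsDefinedBy W D Ψ := by
  obtain ⟨D, hD⟩ := exists_connection h.graded h.related
  have hmixed : ∀ (X : VectorField (𝓡 n) M) (f : C^∞⟮𝓡 n, M; ℝ⟯),
      W.bracket (momentum X) (f ∘ proj) = -momentum (D.toFun (differential f) X) := by
    intro X f
    rw [hD, neg_neg]
    funext z
    rw [mixedValue_differential]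
  choose Ψ hΨ using exists_quadratic_eq_bracket h.graded hmixed
  refine ⟨D, Ψ, fun f g => ?_, hmixed, fun X Y => (hΨ X Y).symm⟩
  funext z
  rw [BivectorField.bracket_eq_form, mvfderiv_pullback, mvfderiv_pullback]
  exact h.related z _ _

theorem IsDefinedBy.connection_unique [T2Space M] {D D' : ContravariantConnection w}
    {Ψ Ψ' : VectorField (𝓡 n) M → VectorField (𝓡 n) M → SymTwo (𝓡 n) M}
    (h : IsDefinedBy W D Ψ) (h' : IsDefinedBy W D' Ψ') : D = D' :=
  ContravariantConnection.ext_differential fun f X =>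
    momentum_injective (neg_injective ((h.mixed X f).symm.trans (h'.mixed X f)))

theorem IsDefinedBy.operator_unique {D D' : ContravariantConnection w}
    {Ψ Ψ' : VectorField (𝓡 n) M → VectorField (𝓡 n) M → SymTwo (𝓡 n) M}
    (h : IsDefinedBy W D Ψ) (h' : IsDefinedBy W D' Ψ') : Ψ = Ψ' := by
  funext X Y
  exact quadratic_injective ((h.momenta X Y).symm.trans (h'.momenta X Y))

end Lift

end Construction

/-! ### The bracket prescribed by a connection and an operator. -/

section Existence

variable {n : ℕ} {M : Type*} [TopologicalSpace M] [ChartedSpace (EuclideanSpace ℝ (Fin n)) M]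
  [IsManifold (𝓡 n) ∞ M] {w : BivectorField (𝓡 n) M}

/-- The algebraic properties of the operator `Ψ` which is defined by the brackets of momenta. -/
structure IsBracketOperator (D : ContravariantConnection w)
    (Ψ : VectorField (𝓡 n) M → VectorField (𝓡 n) M → SymTwo (𝓡 n) M) : Prop where
  skew : ∀ X Y, quadratic (Ψ Y X) = -quadratic (Ψ X Y)
  add_right : ∀ X Y Y', quadratic (Ψ X (Y + Y')) = quadratic (Ψ X Y) + quadratic (Ψ X Y')
  smul_right : ∀ X (f : C^∞⟮𝓡 n, M; ℝ⟯) Y, quadratic (Ψ X (f • Y)) =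
    (f ∘ proj) * quadratic (Ψ X Y) - momentum (D.toFun (differential f) X) * momentum Y

/-- These are the rules of the bivector bracket. The term with `D` is `{m(X), f} m(Y)`. -/
theorem IsDefinedBy.isBracketOperator {W : CotangentBivector n M} {D : ContravariantConnection w}
    {Ψ : VectorField (𝓡 n) M → VectorField (𝓡 n) M → SymTwo (𝓡 n) M}
    (h : IsDefinedBy W D Ψ) : IsBracketOperator D Ψ where
  skew X Y := by rw [← h.momenta, ← h.momenta, W.bracket_skew]
  add_right X Y Y' := by
    rw [← h.momenta, ← h.momenta, ← h.momenta, momentum_add]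
    funext z
    exact W.bracket_add_right (mdifferentiableAt_momentum Y z) (mdifferentiableAt_momentum Y' z)
  smul_right X f Y := by
    rw [← h.momenta, ← h.momenta, momentum_smul]
    funext z
    rw [W.bracket_mul_right (mdifferentiableAt_pullback f z) (mdifferentiableAt_momentum Y z),
      h.mixed]
    simp only [Pi.sub_apply, Pi.mul_apply, Pi.neg_apply]
    ring

theorem ContravariantConnection.leibniz_const (D : ContravariantConnection w) (α : OneForm (𝓡 n) M)
    (c : ℝ) (X : VectorField (𝓡 n) M) :
    momentum (D.toFun α (c • X)) = c • momentum (D.toFun α X) := by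
  have h : w.pair α (differential (ContMDiffMap.const c)) = 0 := by
    ext x
    rw [BivectorField.pair_apply, differential_const]
    exact map_zero _
  rw [section_const_smul, D.leibniz, momentum_add, momentum_smul, momentum_smul, h]
  funext z
  exact (congrArg (c * momentum (D.toFun α X) z + ·) (zero_mul _)).trans (add_zero _)

namespace IsBracketOperator

variable {D : ContravariantConnection w}
  {Ψ : VectorField (𝓡 n) M → VectorField (𝓡 n) M → SymTwo (𝓡 n) M}

theorem add_left (h : IsBracketOperator D Ψ) (X X' Y : VectorField (𝓡 n) M) :
    quadratic (Ψ (X + X') Y) = quadratic (Ψ X Y) + quadratic (Ψ X' Y) := by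
  rw [h.skew Y, h.add_right, h.skew Y X, h.skew Y X', neg_add]

theorem smul_left (h : IsBracketOperator D Ψ) (f : C^∞⟮𝓡 n, M; ℝ⟯) (X Y : VectorField (𝓡 n) M) :
    quadratic (Ψ (f • X) Y) =
      (f ∘ proj) * quadratic (Ψ X Y) + momentum (D.toFun (differential f) Y) * momentum X := by
  rw [h.skew Y, h.smul_right, h.skew Y X]
  ring

theorem const_smul_left (h : IsBracketOperator D Ψ) (c : ℝ) (X Y : VectorField (𝓡 n) M) :
    quadratic (Ψ (c • X) Y) = c • quadratic (Ψ X Y) := by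
  have h0 : D.toFun (0 : OneForm (𝓡 n) M) Y = 0 := map_zero (D.leftHom Y)
  rw [section_const_smul, h.smul_left, differential_const, h0]
  funext z
  have : momentum (0 : VectorField (𝓡 n) M) z = 0 := map_zero z.2
  simp only [Pi.add_apply, Pi.mul_apply, this, zero_mul, add_zero]
  rfl

end IsBracketOperator

/-- The quadratic polynomial of a symmetric tensor field, as a smooth function. -/
def smoothQuadratic (Q : SymTwo (𝓡 n) M) : C^∞⟮cotangentModel n, CotangentBundle n M; ℝ⟯ :=
  ⟨quadratic Q, contMDiff_quadratic Q⟩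

variable (D : ContravariantConnection w)
  (Ψ : VectorField (𝓡 n) M → VectorField (𝓡 n) M → SymTwo (𝓡 n) M)

/-- The bracket of two functions `f + m(X)` and `g + m(Y)` on `T*M` which is prescribed by `w`,
a contravariant connection and an operator. -/
def prescribedBracket (p q : C^∞⟮𝓡 n, M; ℝ⟯ × VectorField (𝓡 n) M) :
    C^∞⟮cotangentModel n, CotangentBundle n M; ℝ⟯ :=
  pullback (w.pair (differential p.1) (differential q.1)) -
    smoothMomentum (D.toFun (differential q.1) p.2) +
    smoothMomentum (D.toFun (differential p.1) q.2) + smoothQuadratic (Ψ p.2 q.2)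

variable {D Ψ}

theorem prescribedBracket_apply (p q : C^∞⟮𝓡 n, M; ℝ⟯ × VectorField (𝓡 n) M)
    (z : CotangentBundle n M) :
    prescribedBracket D Ψ p q z =
      w.tensor.form (proj z) (mvfderiv (𝓡 n) p.1 (proj z)) (mvfderiv (𝓡 n) q.1 (proj z)) -
      momentum (D.toFun (differential q.1) p.2) z + momentum (D.toFun (differential p.1) q.2) z +
      quadratic (Ψ p.2 q.2) z := rfl

theorem prescribedBracket_skew (h : IsBracketOperator D Ψ)
    (p q : C^∞⟮𝓡 n, M; ℝ⟯ × VectorField (𝓡 n) M) (z : CotangentBundle n M) :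
    prescribedBracket D Ψ p q z = -prescribedBracket D Ψ q p z := by
  rw [prescribedBracket_apply, prescribedBracket_apply, w.form_skew, h.skew, Pi.neg_apply]
  ring

/-- The prescribed bracket at a point as a linear function of its first argument. -/
def prescribedBracketLeft (h : IsBracketOperator D Ψ)
    (q : C^∞⟮𝓡 n, M; ℝ⟯ × VectorField (𝓡 n) M) (z : CotangentBundle n M) :
    C^∞⟮𝓡 n, M; ℝ⟯ × VectorField (𝓡 n) M →ₗ[ℝ] ℝ where
  toFun p := prescribedBracket D Ψ p q z
  map_add' p p' := by
    have hd : mvfderiv (𝓡 n) (p.1 + p'.1 : C^∞⟮𝓡 n, M; ℝ⟯) (proj z) =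
        mvfderiv (𝓡 n) p.1 (proj z) + mvfderiv (𝓡 n) p'.1 (proj z) :=
      mvfderiv_add (smooth_mdifferentiableAt p.1 _) (smooth_mdifferentiableAt p'.1 _)
    simp only [prescribedBracket_apply, Prod.fst_add, Prod.snd_add, hd, map_add,
      LinearMap.add_apply, D.add_right, differential_add, D.add_left, momentum_add, h.add_left,
      Pi.add_apply]
    ring
  map_smul' c p := by
    have hd : mvfderiv (𝓡 n) (c • p.1 : C^∞⟮𝓡 n, M; ℝ⟯) (proj z) =
        c • mvfderiv (𝓡 n) p.1 (proj z) :=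
      congrArg (fun α : OneForm (𝓡 n) M => α (proj z)) (differential_const_smul c p.1)
    simp only [prescribedBracket_apply, Prod.smul_fst, Prod.smul_snd, hd, map_smul,
      LinearMap.smul_apply, D.leibniz_const, differential_const_smul, D.smul_left, momentum_smul,
      h.const_smul_left, Pi.smul_apply, Pi.mul_apply, smul_eq_mul, RingHom.id_apply]
    have hc : ((ContMDiffMap.const c : C^∞⟮𝓡 n, M; ℝ⟯) ∘ proj) z = c := rfl
    rw [hc]
    ring

/-- The differential of `f + m(X)` at a point of `T*M`, as a linear function of `(f, X)`. -/
def polynomialDifferential (z : CotangentBundle n M) :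
    C^∞⟮𝓡 n, M; ℝ⟯ × VectorField (𝓡 n) M →ₗ[ℝ]
      (TangentSpace (cotangentModel n) z →L[ℝ] ℝ) where
  toFun p := mvfderiv (cotangentModel n) (pullback p.1 + smoothMomentum p.2 :
    C^∞⟮cotangentModel n, CotangentBundle n M; ℝ⟯) z
  map_add' p q := by
    have h : pullback (p + q).1 + smoothMomentum (p + q).2 =
        (pullback p.1 + smoothMomentum p.2) + (pullback q.1 + smoothMomentum q.2) := by
      ext z
      change _ + momentum (p.2 + q.2) z = _
      rw [momentum_add]
      exact add_add_add_comm _ _ _ _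
    rw [h]
    exact mvfderiv_add (smooth_mdifferentiableAt _ _) (smooth_mdifferentiableAt _ _)
  map_smul' c p := by
    have h : pullback (c • p).1 + smoothMomentum (c • p).2 =
        c • (pullback p.1 + smoothMomentum p.2) := by
      ext z
      change _ + momentum (c • p.2) z = _
      rw [section_const_smul, momentum_smul]
      exact (mul_add c _ _).symm
    rw [h]
    exact congrArg (fun α : OneForm (cotangentModel n) (CotangentBundle n M) => α z)
      (differential_const_smul c _)

theorem polynomialDifferential_function (f : C^∞⟮𝓡 n, M; ℝ⟯) (z : CotangentBundle n M) :
    polynomialDifferential z (f, 0) = mvfderiv (cotangentModel n) (f ∘ proj) z := by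
  refine mvfderiv_congr (Filter.Eventually.of_forall fun z' => ?_)
  exact (congrArg (f (proj z') + ·) (map_zero z'.2)).trans (add_zero _)

theorem polynomialDifferential_vectorField (X : VectorField (𝓡 n) M) (z : CotangentBundle n M) :
    polynomialDifferential z (0, X) = mvfderiv (cotangentModel n) (momentum X) z := by
  refine mvfderiv_congr (Filter.Eventually.of_forall fun z' => ?_)
  exact zero_add (momentum X z')

end Existence

/-! ### The bivector field of a prescribed bracket. -/

section Existence

variable {n : ℕ} {M : Type*} [TopologicalSpace M] [ChartedSpace (EuclideanSpace ℝ (Fin n)) M]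
  [IsManifold (𝓡 n) ∞ M] {w : BivectorField (𝓡 n) M}

/-- The pairs `(xⁱ, 0)` and `(0, e_i)` of a local frame. -/
def LocalFrame.generator {y : M} (F : LocalFrame (𝓡 n) (Fin n) y) :
    Fin n ⊕ Fin n → C^∞⟮𝓡 n, M; ℝ⟯ × VectorField (𝓡 n) M :=
  Sum.elim (fun i => (F.coord i, 0)) fun i => (0, F.frame i)

/-- The components of `d(f + m(X))` at a point of `T*M` in a local frame. -/
def LocalFrame.coefficient {y : M} (F : LocalFrame (𝓡 n) (Fin n) y) (z : CotangentBundle n M)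
    (p : C^∞⟮𝓡 n, M; ℝ⟯ × VectorField (𝓡 n) M) : Fin n ⊕ Fin n → ℝ :=
  Sum.elim (fun i => mvfderiv (𝓡 n) p.1 (proj z) (F.frame i (proj z)) +
      ∑ j, momentum (F.frame j) z *
        mvfderiv (𝓡 n) (F.comp p.2 j) (proj z) (F.frame i (proj z)))
    fun j => F.comp p.2 j (proj z)

/-- A linear map on pairs `(f, X)` which depends on `f` only through `df` at a point and satisfies
a Leibniz rule is determined by its values on the generators. -/
theorem LocalFrame.linear_eq_sum {V : Type*} [AddCommGroup V] [Module ℝ V]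
    {z : CotangentBundle n M} (F : LocalFrame (𝓡 n) (Fin n) (proj z))
    (Λ : C^∞⟮𝓡 n, M; ℝ⟯ × VectorField (𝓡 n) M →ₗ[ℝ] V)
    (h1 : ∀ f : C^∞⟮𝓡 n, M; ℝ⟯, Λ (f, 0) =
      ∑ i, mvfderiv (𝓡 n) f (proj z) (F.frame i (proj z)) • Λ (F.coord i, 0))
    (h2 : ∀ (f : C^∞⟮𝓡 n, M; ℝ⟯) (X : VectorField (𝓡 n) M),
      Λ (0, f • X) = f (proj z) • Λ (0, X) + momentum X z • Λ (f, 0))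
    (p : C^∞⟮𝓡 n, M; ℝ⟯ × VectorField (𝓡 n) M) :
    Λ p = ∑ a, F.coefficient z p a • Λ (F.generator a) := by
  obtain ⟨f, X⟩ := p
  -- The cutoff has value `1` and differential `0` at the point. Hence `Λ (0, X)` equals `Λ (0,
  -- F.cutoff • X)`, and the latter expands in the frame.
  have hρ : Λ (F.cutoff, 0) = 0 := by
    rw [h1, F.mvfderiv_cutoff]
    simp
  have hX : Λ (0, X) = ∑ j, (F.comp X j (proj z) • Λ (0, F.frame j) +
      momentum (F.frame j) z • Λ (F.comp X j, 0)) := by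
    have h := h2 F.cutoff X
    rw [hρ, smul_zero, add_zero, F.cutoff_eq_one, one_smul, F.cutoff_smul_vectorField] at h
    rw [← h]
    have hs := map_sum (Λ ∘ₗ LinearMap.inr ℝ C^∞⟮𝓡 n, M; ℝ⟯ (VectorField (𝓡 n) M))
      (fun j => F.comp X j • F.frame j) Finset.univ
    refine Eq.trans hs ?_
    exact Finset.sum_congr rfl fun j _ => h2 _ _
  have hp : Λ (f, X) = Λ (f, 0) + Λ (0, X) := by
    rw [← map_add, Prod.mk_add_mk, add_zero, zero_add]
  rw [hp, h1, hX, Fintype.sum_sum_type, Finset.sum_add_distrib]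
  simp only [LocalFrame.coefficient, LocalFrame.generator, Sum.elim_inl, Sum.elim_inr, add_smul,
    Finset.sum_add_distrib, Finset.sum_smul]
  have hc : ∑ j, momentum (F.frame j) z • Λ (F.comp X j, 0) =
      ∑ i, ∑ j, (momentum (F.frame j) z *
        mvfderiv (𝓡 n) (F.comp X j) (proj z) (F.frame i (proj z))) • Λ (F.coord i, 0) := by
    rw [Finset.sum_comm]
    refine Finset.sum_congr rfl fun j _ => ?_
    rw [h1, Finset.smul_sum]
    exact Finset.sum_congr rfl fun i _ => smul_smul _ _ _
  rw [hc]
  abel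

theorem polynomialDifferential_generator {y : M} (F : LocalFrame (𝓡 n) (Fin n) y)
    (a : Fin n ⊕ Fin n) (z : CotangentBundle n M) :
    polynomialDifferential z (F.generator a) =
      mvfderiv (cotangentModel n) (F.cotangentCoord a) z := by
  rcases a with i | i
  · exact polynomialDifferential_function _ z
  · exact polynomialDifferential_vectorField _ z

theorem polynomialDifferential_eq_sum {z : CotangentBundle n M}
    (F : LocalFrame (𝓡 n) (Fin n) (proj z)) (p : C^∞⟮𝓡 n, M; ℝ⟯ × VectorField (𝓡 n) M) :
    polynomialDifferential z p =
      ∑ a, F.coefficient z p a • polynomialDifferential z (F.generator a) := by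
  refine F.linear_eq_sum (polynomialDifferential z) (fun f => ?_) (fun f X => ?_) p
  · simp only [polynomialDifferential_function, mvfderiv_pullback]
    refine ContinuousLinearMap.ext fun v => ?_
    have h := DFunLike.congr_fun (F.covector_eq_sum F.cutoff_eq_one (mvfderiv (𝓡 n) f (proj z)))
      (mfderiv (cotangentModel n) (𝓡 n) proj z v)
    simp only [_root_.sum_apply, _root_.smul_apply] at h ⊢
    exact h
  · rw [polynomialDifferential_vectorField, polynomialDifferential_vectorField,
      polynomialDifferential_function, momentum_smul,
      mvfderiv_mul (mdifferentiableAt_pullback f z) (mdifferentiableAt_momentum X z)]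
    rfl

variable {D : ContravariantConnection w}
  {Ψ : VectorField (𝓡 n) M → VectorField (𝓡 n) M → SymTwo (𝓡 n) M}

/-- The coefficients are those of `polynomialDifferential_eq_sum`, because bracket and differential
obey the same Leibniz rule. So the bracket depends on its first argument only through the
differential at `z`. -/
theorem prescribedBracket_eq_sum (h : IsBracketOperator D Ψ) {z : CotangentBundle n M}
    (F : LocalFrame (𝓡 n) (Fin n) (proj z)) (p q : C^∞⟮𝓡 n, M; ℝ⟯ × VectorField (𝓡 n) M) :
    prescribedBracket D Ψ p q z =
      ∑ a, F.coefficient z p a * prescribedBracket D Ψ (F.generator a) q z := by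
  have hq : ∀ Y, quadratic (Ψ 0 Y) z = 0 := fun Y => by
    have h0 := congrFun (h.add_left 0 0 Y) z
    rw [add_zero, Pi.add_apply] at h0
    linarith
  have hD : ∀ α, momentum (D.toFun α 0) z = 0 := fun α => by
    have h0 : D.toFun α 0 = 0 := map_zero (D.rightHom α)
    rw [h0]
    exact map_zero z.2
  have hd0 : mvfderiv (𝓡 n) (0 : C^∞⟮𝓡 n, M; ℝ⟯) (proj z) = 0 := mvfderiv_const 0
  have hD0 : ∀ Y, momentum (D.toFun (differential 0) Y) z = 0 := fun Y => by
    have h0 : differential (0 : C^∞⟮𝓡 n, M; ℝ⟯) = 0 := map_zero (differentialLinear (𝓡 n) M)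
    have h1 : D.toFun 0 Y = 0 := map_zero (D.leftHom Y)
    rw [h0, h1]
    exact map_zero z.2
  refine F.linear_eq_sum (prescribedBracketLeft h q z) (fun f => ?_) (fun f X => ?_) p
  · change prescribedBracket D Ψ (f, 0) q z = ∑ i, _ * prescribedBracket D Ψ (F.coord i, 0) q z
    simp only [prescribedBracket_apply, hq, hD, sub_zero, add_zero]
    conv_lhs => rw [F.covector_eq_sum F.cutoff_eq_one (mvfderiv (𝓡 n) f (proj z))]
    simp only [map_sum, map_smul, LinearMap.sum_apply, LinearMap.smul_apply, smul_eq_mul, mul_add,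
      Finset.sum_add_distrib]
    congr 1
    have h1 : D.toFun (differential f) q.2 (proj z) = _ :=
      D.apply_eq_sum F F.cutoff_eq_one (differential f) q.2
    refine (congrArg z.2 h1).trans ((map_sum (show TangentSpace (𝓡 n) z.1 →L[ℝ] ℝ from z.2)
      _ _).trans ?_)
    refine (Finset.sum_congr rfl fun i _ => ?_)
    exact map_smul z.2 _ _
  · change prescribedBracket D Ψ (0, f • X) q z = f (proj z) * prescribedBracket D Ψ (0, X) q z +
      momentum X z * prescribedBracket D Ψ (f, 0) q z
    simp only [prescribedBracket_apply, hq, hD, hd0, hD0, map_zero, LinearMap.zero_apply, sub_zero,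
      add_zero, zero_sub, D.leibniz, h.smul_left, momentum_add, momentum_smul, Pi.add_apply,
      Pi.mul_apply, Function.comp_apply]
    -- The Leibniz rule of `D` contributes `-w(dg, df) m(X)`, with `g` the function in `q`; by
    -- skewness this is the term `m(X) w(df, dg)` on the right.
    rw [BivectorField.pair_apply, w.form_skew]
    simp only [differential_apply]
    ring

theorem apply_sum_tensorVec {V ι : Type*} [Fintype ι] [AddCommGroup V] [Module ℝ V]
    [TopologicalSpace V] [IsTopologicalAddGroup V] [ContinuousSMul ℝ V] (c : ι → ι → ℝ) (e : ι → V)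
    (α β : V →L[ℝ] ℝ) :
    β ((∑ a, ∑ b, c a b • tensorVec (e a) (e b)) α) = ∑ a, ∑ b, c a b * (α (e a) * β (e b)) := by
  simp only [_root_.sum_apply, map_sum]
  refine Finset.sum_congr rfl fun a _ => Finset.sum_congr rfl fun b _ => ?_
  change β (c a b • α (e a) • e b) = _
  simp only [map_smul, smul_eq_mul]

/-- A bracket on a family of functions which is compatible with the differentials of the functions
is defined by a bivector field. -/
theorem exists_bivectorField_of_bracket {E : Type*} [NormedAddCommGroup E] [NormedSpace ℝ E]
    {H : Type*} [TopologicalSpace H] {I : ModelWithCorners ℝ E H}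
    {N : Type*} [TopologicalSpace N] [ChartedSpace H N] [IsManifold I ∞ N]
    {K ι : Type*} [Fintype ι] [DecidableEq ι] (d : K → C^∞⟮I, N; ℝ⟯) (B : K → K → C^∞⟮I, N; ℝ⟯)
    (hB : ∀ p q z, B p q z = -B q p z)
    (h : ∀ z, ∃ (G : LocalFrame I ι z) (g : ι → K), (∀ a, (G.coord a : N → ℝ) =ᶠ[𝓝 z] d (g a)) ∧
      (∃ v : ι → TangentSpace I z, ∀ a b, mvfderiv I (d (g a)) z (v b) = if b = a then 1 else 0) ∧
      ∀ p, ∃ c : ι → ℝ, (∀ q, B p q z = ∑ a, c a * B (g a) q z) ∧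
        mvfderiv I (d p) z = ∑ a, c a • mvfderiv I (d (g a)) z) :
    ∃ W : BivectorField I N, ∀ p q z, W.bracket (d p) (d q) z = B p q z := by
  choose G g hg hv hc using h
  -- The frame is chosen anew at each `z`, so smoothness is not evident. It follows once `ht`
  -- describes `t` without reference to the choice.
  let t : ∀ z : N, (TangentSpace I z →L[ℝ] ℝ) →L[ℝ] TangentSpace I z := fun z =>
    ∑ a, ∑ b, B (g z a) (g z b) z • tensorVec ((G z).frame a z) ((G z).frame b z)
  have hc' : ∀ z p q, B p q z = ∑ a, mvfderiv I (d p) z ((G z).frame a z) * B (g z a) q z := by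
    intro z p q
    obtain ⟨v, hv⟩ := hv z
    obtain ⟨c, hcB, hcd⟩ := hc z p
    rw [hcB]
    refine Finset.sum_congr rfl fun a _ => ?_
    -- Expanding `v a` in the frame shows that the frame is the dual basis. This identifies the
    -- unspecified coefficient `c a` as the derivative of `d p` along the frame field.
    have hva : (G z).frame a z = v a := by
      have h1 := (G z).cutoff_smul z (v a)
      rw [(G z).cutoff_eq_one, one_smul] at h1
      rw [h1]
      simp [mvfderiv_congr (hg z _), hv]
    rw [hva, hcd, _root_.sum_apply]
    simp [hv]
  have ht : ∀ z p q, mvfderiv I (d q) z (t z (mvfderiv I (d p) z)) = B p q z := by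
    intro z p q
    rw [apply_sum_tensorVec, hc' z p q]
    refine Finset.sum_congr rfl fun a _ => ?_
    rw [hB, hc' z q, ← Finset.sum_neg_distrib, Finset.mul_sum]
    refine Finset.sum_congr rfl fun b _ => ?_
    rw [hB (g z a)]
    ring
  -- The differentials of the functions chosen at `z₀` still span the covectors at nearby `z`, and
  -- on them `ht` gives `t z` the same values as the tensor built from the fixed frame at `z₀`.
  have hsmooth : ∀ z₀, ∃ P : ContraTwo I N, ∀ᶠ z in 𝓝 z₀, P z = t z := by
    intro z₀
    refine ⟨∑ a, ∑ b, B (g z₀ a) (g z₀ b) • tensorProd ((G z₀).frame a) ((G z₀).frame b), ?_⟩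
    filter_upwards [(G z₀).cutoff_eq,
      Filter.eventually_all.2 fun a => eventually_eventually_nhds.2 (hg z₀ a)] with z hz hgz
    have hP : (∑ a, ∑ b, B (g z₀ a) (g z₀ b) • tensorProd ((G z₀).frame a) ((G z₀).frame b) :
        ContraTwo I N) z = ∑ a, ∑ b, B (g z₀ a) (g z₀ b) z •
          tensorVec ((G z₀).frame a z) ((G z₀).frame b z) := by
      simp only [section_sum_apply]
      rfl
    rw [hP]
    refine ContinuousLinearMap.ext fun α => eq_of_forall_covector fun β => ?_
    rw [apply_sum_tensorVec]
    have hγ : ∀ γ : TangentSpace I z →L[ℝ] ℝ,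
        γ = ∑ a, γ ((G z₀).frame a z) • mvfderiv I (d (g z₀ a)) z := by
      intro γ
      conv_lhs => rw [(G z₀).covector_eq_sum hz γ]
      exact Finset.sum_congr rfl fun a _ => by rw [mvfderiv_congr (hgz a)]
    conv_rhs => rw [hγ α, hγ β]
    simp only [map_sum, map_smul, _root_.sum_apply, _root_.smul_apply, smul_eq_mul, ht]
    simp only [Finset.mul_sum]
    exact Finset.sum_congr rfl fun a _ => Finset.sum_congr rfl fun b _ => by ring
  refine ⟨⟨⟨t, fun z₀ => ?_⟩, fun z α β => ?_⟩, fun p q z => ht z p q⟩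
  · obtain ⟨P, hP⟩ := hsmooth z₀
    refine (P.contMDiff z₀).congr_of_eventuallyEq ?_
    filter_upwards [hP] with z hz
    rw [hz]
  · change β (t z α) = -α (t z β)
    rw [apply_sum_tensorVec, apply_sum_tensorVec, Finset.sum_comm, ← Finset.sum_neg_distrib]
    refine Finset.sum_congr rfl fun a _ => ?_
    rw [← Finset.sum_neg_distrib]
    refine Finset.sum_congr rfl fun b _ => ?_
    rw [hB]
    ring

theorem polynomialFunction_generator {y : M} (F : LocalFrame (𝓡 n) (Fin n) y)
    (a : Fin n ⊕ Fin n) :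
    pullback (F.generator a).1 + smoothMomentum (F.generator a).2 = F.cotangentCoord a := by
  ext z
  rcases a with i | i
  · exact (congrArg (F.coord i (proj z) + ·) (map_zero z.2)).trans (add_zero _)
  · exact zero_add (momentum (F.frame i) z)

theorem dual_modelBasis {z : CotangentBundle n M} {F : LocalFrame (𝓡 n) (Fin n) (proj z)}
    (hF : F.Extends (proj z) (proj z)) :
    ∃ v : Fin n ⊕ Fin n → TangentSpace (cotangentModel n) z, ∀ a b,
      polynomialDifferential z (F.generator a) (v b) = if b = a then 1 else 0 := by
  refine ⟨fun b => modelBasis n b, fun a b => ?_⟩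
  rw [polynomialDifferential_generator, mvfderiv_cotangentCoord hF]
  exact modelCoord_modelBasis a b

/-- A connection and an operator with the right algebraic properties define a bivector field. -/
theorem IsBracketOperator.exists_isDefinedBy [T2Space M] (h : IsBracketOperator D Ψ) :
    ∃ W : CotangentBivector n M, IsDefinedBy W D Ψ := by
  obtain ⟨W, hW⟩ := exists_bivectorField_of_bracket (I := cotangentModel n)
    (fun p : C^∞⟮𝓡 n, M; ℝ⟯ × VectorField (𝓡 n) M => pullback p.1 + smoothMomentum p.2)
    (prescribedBracket D Ψ) (prescribedBracket_skew h) (ι := Fin n ⊕ Fin n) (fun z => by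
      obtain ⟨F, hF⟩ := exists_localFrame_self (n := n) (proj z)
      -- The frame `F` of `M` supplies functions `xⁱ` and `p_i` on which the bracket is prescribed.
      -- The frame `G` of `T*M` supplies smooth vector fields dual to their differentials.
      obtain ⟨G, hG, -⟩ := exists_localFrame (I := cotangentModel n) (modelBasis n)
        (mem_extChartAt_source z)
      refine ⟨G, F.generator, fun a => ?_, dual_modelBasis hF, fun p =>
        ⟨F.coefficient z p, fun q => prescribedBracket_eq_sum h F p q,
          polynomialDifferential_eq_sum F p⟩⟩
      filter_upwards [hG a, cotangentCoord_eventuallyEq hF a] with z' h1 h2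
      rw [h1, modelBasis_coord, ← h2, polynomialFunction_generator])
  have hW' : ∀ p q z, W.tensor.form z (polynomialDifferential z p) (polynomialDifferential z q) =
      prescribedBracket D Ψ p q z := hW
  have hq : ∀ Y z, quadratic (Ψ 0 Y) z = 0 := fun Y z => by
    have h0 := congrFun (h.add_left 0 0 Y) z
    rw [add_zero, Pi.add_apply] at h0
    linarith
  have hq' : ∀ Y z, quadratic (Ψ Y 0) z = 0 := fun Y z => by
    rw [h.skew, Pi.neg_apply, hq, neg_zero]
  have hD : ∀ α z, momentum (D.toFun α 0) z = 0 := fun α z => by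
    have h0 : D.toFun α 0 = 0 := map_zero (D.rightHom α)
    rw [h0]
    exact map_zero z.2
  have hd0 : ∀ x, mvfderiv (𝓡 n) (0 : C^∞⟮𝓡 n, M; ℝ⟯) x = 0 := fun x => mvfderiv_const 0
  have hD0 : ∀ Y z, momentum (D.toFun (differential 0) Y) z = 0 := fun Y z => by
    have h0 : differential (0 : C^∞⟮𝓡 n, M; ℝ⟯) = 0 := map_zero (differentialLinear (𝓡 n) M)
    have h1 : D.toFun 0 Y = 0 := map_zero (D.leftHom Y)
    rw [h0, h1]
    exact map_zero z.2
  refine ⟨W, fun f g => ?_, fun X f => ?_, fun X Y => ?_⟩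
  · funext z
    rw [BivectorField.bracket_eq_form, ← polynomialDifferential_function,
      ← polynomialDifferential_function, hW', prescribedBracket_apply]
    simp only [hD, hq, sub_zero, add_zero]
    rfl
  · funext z
    rw [BivectorField.bracket_eq_form, ← polynomialDifferential_function,
      ← polynomialDifferential_vectorField, hW', prescribedBracket_apply]
    simp only [hD, hq', hd0, map_zero, LinearMap.zero_apply, zero_sub, add_zero]
    rfl
  · funext z
    rw [BivectorField.bracket_eq_form, ← polynomialDifferential_vectorField,
      ← polynomialDifferential_vectorField, hW', prescribedBracket_apply]
    simp only [hD0, hd0, map_zero, sub_zero, zero_add]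

end Existence

/-! ### Operators with a given symbol, and the affine structure of the lifts. -/

section Affine

variable {n : ℕ} {M : Type*} [TopologicalSpace M] [ChartedSpace (EuclideanSpace ℝ (Fin n)) M]
  [IsManifold (𝓡 n) ∞ M] {w : BivectorField (𝓡 n) M} {τ : TensorTwoOne (𝓡 n) M}
  {A : VectorField (𝓡 n) M → VectorField (𝓡 n) M → SymTwo (𝓡 n) M}

/-- The symbol rule already contains the order condition: its extra term is linear over functions in
`Y`, so it cancels in the double commutator. Real homogeneity holds as constants have zero
differential, and skewness transfers everything to the first argument. -/
theorem IsSkewOperatorWithSymbol.of_quadratic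
    (hskew : ∀ X Y, quadratic (A Y X) = -quadratic (A X Y))
    (hadd : ∀ X Y Y', quadratic (A X (Y + Y')) = quadratic (A X Y) + quadratic (A X Y'))
    (hsymbol : ∀ X (f : C^∞⟮𝓡 n, M; ℝ⟯) Y, quadratic (A X (f • Y)) =
      (f ∘ proj) * quadratic (A X Y) - momentum (τ (differential f) X) * momentum Y) :
    IsSkewOperatorWithSymbol τ A := by
  have hskew' : ∀ X Y, A Y X = -A X Y := fun X Y => by
    apply quadratic_injective
    rw [quadratic_neg, hskew]
  have hadd' : ∀ X Y Y', A X (Y + Y') = A X Y + A X Y' := fun X Y Y' => by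
    apply quadratic_injective
    rw [quadratic_add, hadd]
  have hsymbol' : ∀ X (f : C^∞⟮𝓡 n, M; ℝ⟯) Y,
      A X (f • Y) = f • A X Y - symProd (τ (differential f) X) Y := fun X f Y => by
    apply quadratic_injective
    rw [quadratic_sub, quadratic_smul, quadratic_symProd, hsymbol]
  have hleft : ∀ (f : C^∞⟮𝓡 n, M; ℝ⟯) X Y, quadratic (A (f • X) Y) =
      (f ∘ proj) * quadratic (A X Y) + momentum (τ (differential f) Y) * momentum X :=
    fun f X Y => by
      rw [hskew Y, hsymbol, hskew X Y]
      ring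
  have hconst : ∀ (c : ℝ) X Y, quadratic (A X (c • Y)) =
      quadratic ((ContMDiffMap.const c : C^∞⟮𝓡 n, M; ℝ⟯) • A X Y) := fun c X Y => by
    have h0 : momentum (0 : VectorField (𝓡 n) M) = 0 := funext fun z => map_zero z.2
    rw [section_const_smul, hsymbol, differential_const, map_zero, LinearMap.zero_apply,
      h0, zero_mul, sub_zero, quadratic_smul]
  refine ⟨⟨fun X X' Y => ?_, hadd', fun c X Y => ?_, fun c X Y => ?_, fun f g X Y => ?_,
    fun f g X Y => ?_⟩, hskew', hsymbol'⟩
  · apply quadratic_injective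
    rw [quadratic_add, hskew Y, hadd, hskew X, hskew X', neg_add, neg_neg, neg_neg]
  · have h : A (c • X) Y = (ContMDiffMap.const c : C^∞⟮𝓡 n, M; ℝ⟯) • A X Y := by
      apply quadratic_injective
      rw [hskew Y, hconst, quadratic_smul, quadratic_smul, hskew X Y, mul_neg, neg_neg]
    exact congrArg Subtype.val h
  · exact congrArg Subtype.val (quadratic_injective (hconst c X Y))
  · apply quadratic_injective
    simp only [quadratic_add, quadratic_sub, quadratic_smul, hleft, momentum_smul, quadratic_zero]
    ring
  · apply quadratic_injective
    simp only [quadratic_add, quadratic_sub, quadratic_smul, hsymbol, momentum_smul,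
      quadratic_zero]
    ring

namespace IsSkewOperatorWithSymbol

theorem quadratic_smul_right (hA : IsSkewOperatorWithSymbol τ A) (X : VectorField (𝓡 n) M) (f : C^∞⟮𝓡 n, M; ℝ⟯)
    (Y : VectorField (𝓡 n) M) : quadratic (A X (f • Y)) =
      (f ∘ proj) * quadratic (A X Y) - momentum (τ (differential f) X) * momentum Y := by
  rw [hA.symbol, quadratic_sub, quadratic_smul, quadratic_symProd]

theorem quadratic_skew (hA : IsSkewOperatorWithSymbol τ A) (X Y : VectorField (𝓡 n) M) :
    quadratic (A Y X) = -quadratic (A X Y) := by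
  rw [hA.skew, quadratic_neg]

theorem quadratic_add_right (hA : IsSkewOperatorWithSymbol τ A) (X Y Y' : VectorField (𝓡 n) M) :
    quadratic (A X (Y + Y')) = quadratic (A X Y) + quadratic (A X Y') := by
  rw [hA.bidifferential.add_right, quadratic_add]

end IsSkewOperatorWithSymbol

section LocalOperator

variable {y : M} (F : LocalFrame (𝓡 n) (Fin n) y) (τ)

/-- The operator with symbol `τ` which is defined by a local frame: it vanishes on the vector
fields of the frame. -/
def LocalFrame.operator (X Y : VectorField (𝓡 n) M) : SymTwo (𝓡 n) M :=
  ∑ j, symProd (τ (differential (F.comp X j)) Y) (F.frame j) -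
    ∑ j, symProd (τ (differential (F.comp Y j)) X) (F.frame j)

theorem LocalFrame.quadratic_operator (X Y : VectorField (𝓡 n) M) :
    quadratic (F.operator τ X Y) =
      ∑ j, momentum (τ (differential (F.comp X j)) Y) * momentum (F.frame j) -
        ∑ j, momentum (τ (differential (F.comp Y j)) X) * momentum (F.frame j) := by
  simp only [LocalFrame.operator, quadratic_sub, quadratic_sum, quadratic_symProd]

theorem LocalFrame.comp_add (X Y : VectorField (𝓡 n) M) (j : Fin n) :
    F.comp (X + Y) j = F.comp X j + F.comp Y j := by
  ext x
  exact map_add (mvfderiv (𝓡 n) (F.coord j) x) (X x) (Y x)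

theorem LocalFrame.comp_smul (f : C^∞⟮𝓡 n, M; ℝ⟯) (X : VectorField (𝓡 n) M) (j : Fin n) :
    F.comp (f • X) j = f * F.comp X j := by
  ext x
  exact map_smul (mvfderiv (𝓡 n) (F.coord j) x) (f x) (X x)

theorem LocalFrame.quadratic_operator_skew (X Y : VectorField (𝓡 n) M) :
    quadratic (F.operator τ Y X) = -quadratic (F.operator τ X Y) := by
  rw [F.quadratic_operator, F.quadratic_operator, neg_sub]

theorem LocalFrame.quadratic_operator_add (X Y Y' : VectorField (𝓡 n) M) :
    quadratic (F.operator τ X (Y + Y')) =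
      quadratic (F.operator τ X Y) + quadratic (F.operator τ X Y') := by
  simp only [F.quadratic_operator, F.comp_add, differential_add, map_add, LinearMap.add_apply,
    momentum_add, add_mul, Finset.sum_add_distrib]
  ring

/-- Differentiating the components `f Yʲ` produces `τ(df, X) ⊙ ∑ Yʲ e_j`, and the sum is the cutoff
times `Y`. So the symbol is correct where the cutoff is `1`. -/
theorem LocalFrame.quadratic_operator_smul (X : VectorField (𝓡 n) M) (f : C^∞⟮𝓡 n, M; ℝ⟯)
    (Y : VectorField (𝓡 n) M) :
    quadratic (F.operator τ X (f • Y)) = (f ∘ proj) * quadratic (F.operator τ X Y) -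
      (F.cutoff ∘ proj) * (momentum (τ (differential f) X) * momentum Y) := by
  have hY : (F.cutoff ∘ proj) * momentum Y =
      ∑ j, (F.comp Y j ∘ proj) * momentum (F.frame j) := by
    rw [← momentum_smul, F.cutoff_smul_vectorField, momentum_sum]
    exact Finset.sum_congr rfl fun j _ => momentum_smul _ _
  rw [mul_left_comm, hY]
  simp only [F.quadratic_operator, F.comp_smul, differential_mul, map_add, map_smul,
    LinearMap.add_apply, LinearMap.smul_apply, momentum_add, momentum_smul, add_mul,
    Finset.sum_add_distrib, mul_sub, Finset.mul_sum]
  rw [← sub_sub]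
  exact congrArg₂ _ (congrArg₂ _ (Finset.sum_congr rfl fun j _ => by ring)
    (Finset.sum_congr rfl fun j _ => by ring)) (Finset.sum_congr rfl fun j _ => by ring)

end LocalOperator

/-- Operators with symbol `τ` form an affine space, so the frame operators may be averaged by a
partition of unity. Each weight is supported where its cutoff is `1`, which removes the cutoff from
the symbol. -/
theorem exists_isSkewOperatorWithSymbol [T2Space M] [SecondCountableTopology M]
    (τ : TensorTwoOne (𝓡 n) M) : ∃ A, IsSkewOperatorWithSymbol τ A := by
  have : LocallyCompactSpace M := ChartedSpace.locallyCompactSpace (EuclideanSpace ℝ (Fin n)) M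
  choose F _ using fun x : M => exists_localFrame_self (n := n) x
  obtain ⟨η, hη⟩ := SmoothPartitionOfUnity.exists_isSubordinate (𝓡 n) (s := Set.univ)
    isClosed_univ (fun y => interior {x | (F y).cutoff x = 1}) (fun _ => isOpen_interior)
    fun y _ => Set.mem_iUnion.2 ⟨y, mem_interior_iff_mem_nhds.2 (F y).cutoff_eq⟩
  have hcut : ∀ y x, y ∈ η.finsupport x → (F y).cutoff x = 1 := fun y x hy =>
    interior_subset (s := {x | (F y).cutoff x = 1}) (hη y (subset_closure ((η.mem_finsupport x).1 hy)))
  have hA : ∀ X Y, ∃ Q : SymTwo (𝓡 n) M, quadratic Q = fun z =>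
      ∑ y ∈ η.finsupport (proj z), η y (proj z) * quadratic ((F y).operator τ X Y) z := by
    -- The index set `finsupport` varies with the point. Near `x₀` it lies in the fixed finite set
    -- `fintsupport x₀`, and the added terms have weight zero.
    refine fun X Y => exists_quadratic_eq fun x₀ =>
      ⟨∑ y ∈ η.fintsupport x₀, η y • (F y).operator τ X Y, ?_⟩
    filter_upwards [η.eventually_fintsupport_subset x₀] with x hx α
    rw [quadratic_sum, Finset.sum_apply]
    simp only [quadratic_smul]
    refine Finset.sum_subset ((η.finsupport_subset_fintsupport x).trans hx) fun y _ hy => ?_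
    have h0 : η y x = 0 := by
      by_contra h0
      exact hy ((η.mem_finsupport x).2 h0)
    exact mul_eq_zero_of_left h0 _
  choose A hA using hA
  refine ⟨A, .of_quadratic (fun X Y => ?_) (fun X Y Y' => ?_) (fun X f Y => ?_)⟩
  · rw [hA, hA]
    funext z
    simp only [Pi.neg_apply, (F _).quadratic_operator_skew τ X Y, mul_neg, Finset.sum_neg_distrib]
  · rw [hA, hA, hA]
    funext z
    simp only [Pi.add_apply, LocalFrame.quadratic_operator_add, mul_add, Finset.sum_add_distrib]
  · rw [hA, hA]
    funext z
    have h1 := η.sum_finsupport (proj z) (Set.mem_univ _)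
    have h2 : ∑ y ∈ η.finsupport (proj z), η y (proj z) *
        ((F y).cutoff (proj z) * (momentum (τ (differential f) X) z * momentum Y z)) =
          momentum (τ (differential f) X) z * momentum Y z := by
      refine Eq.trans ?_ (one_mul (momentum (τ (differential f) X) z * momentum Y z))
      rw [← h1, Finset.sum_mul]
      refine Finset.sum_congr rfl fun y hy => ?_
      rw [hcut y _ hy, one_mul]
    simp only [Pi.sub_apply, Pi.mul_apply, Function.comp_apply, LocalFrame.quadratic_operator_smul,
      mul_sub, Finset.sum_sub_distrib, Finset.mul_sum]
    rw [h2]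
    simp only [mul_left_comm]

variable {D D₀ : ContravariantConnection w}
  {Ψ Ψ₀ : VectorField (𝓡 n) M → VectorField (𝓡 n) M → SymTwo (𝓡 n) M}

/-- The only term that is not linear over functions, `(α^♯ f) X`, depends on `w` alone and cancels.
-/
theorem ContravariantConnection.exists_difference (D D₀ : ContravariantConnection w) :
    ∃ τ : TensorTwoOne (𝓡 n) M, ∀ α X, D.toFun α X = D₀.toFun α X + τ α X := by
  refine ⟨LinearMap.mk₂ C^∞⟮𝓡 n, M; ℝ⟯ (fun α X => D.toFun α X - D₀.toFun α X)
    (fun α β X => ?_) (fun f α X => ?_) (fun α X Y => ?_) (fun f α X => ?_), fun α X => ?_⟩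
  · rw [D.add_left, D₀.add_left, add_sub_add_comm]
  · rw [D.smul_left, D₀.smul_left, smul_sub]
  · rw [D.add_right, D₀.add_right, add_sub_add_comm]
  · rw [D.leibniz, D₀.leibniz, add_sub_add_right_eq_sub, smul_sub]
  · rw [LinearMap.mk₂_apply, add_sub_cancel]

/-- The symbols of `Ψ₀` and `A` add up to that of `D = D₀ + τ`, and `T` contributes none. -/
theorem IsBracketOperator.add (h : IsBracketOperator D₀ Ψ₀)
    (hτ : ∀ α X, D.toFun α X = D₀.toFun α X + τ α X) (hA : IsSkewOperatorWithSymbol τ A)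
    {T : SymTensorTwoTwo (𝓡 n) M} (hT : ∀ X Y, T Y X = -T X Y) :
    IsBracketOperator D fun X Y => Ψ₀ X Y + A X Y + T X Y where
  skew X Y := by
    simp only [quadratic_add, h.skew X Y, hA.quadratic_skew X Y, hT X Y, quadratic_neg]
    ring
  add_right X Y Y' := by
    simp only [quadratic_add, h.add_right, hA.quadratic_add_right, map_add]
    ring
  smul_right X f Y := by
    simp only [quadratic_add, h.smul_right, hA.quadratic_smul_right, map_smul, quadratic_smul,
      hτ, momentum_add]
    ring

/-- In `Ψ - Ψ₀ - A` the symbols cancel, which leaves linearity over functions in the second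
argument; skewness gives it in the first. -/
theorem IsBracketOperator.exists_tensor (h : IsBracketOperator D Ψ) (h₀ : IsBracketOperator D₀ Ψ₀)
    (hτ : ∀ α X, D.toFun α X = D₀.toFun α X + τ α X) (hA : IsSkewOperatorWithSymbol τ A) :
    ∃ T : SymTensorTwoTwo (𝓡 n) M,
      (∀ X Y, T Y X = -T X Y) ∧ ∀ X Y, Ψ X Y = Ψ₀ X Y + A X Y + T X Y := by
  let t : VectorField (𝓡 n) M → VectorField (𝓡 n) M → SymTwo (𝓡 n) M :=
    fun X Y => Ψ X Y - Ψ₀ X Y - A X Y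
  have ht : ∀ X Y, quadratic (t X Y) = quadratic (Ψ X Y) - quadratic (Ψ₀ X Y) - quadratic (A X Y) :=
    fun X Y => by rw [quadratic_sub, quadratic_sub]
  have hskew : ∀ X Y, t Y X = -t X Y := fun X Y => by
    apply quadratic_injective
    rw [quadratic_neg, ht, ht, h.skew X Y, h₀.skew X Y, hA.quadratic_skew X Y]
    ring
  have hadd : ∀ X Y Y', t X (Y + Y') = t X Y + t X Y' := fun X Y Y' => by
    apply quadratic_injective
    rw [quadratic_add, ht, ht, ht, h.add_right, h₀.add_right, hA.quadratic_add_right]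
    ring
  have hsmul : ∀ X (f : C^∞⟮𝓡 n, M; ℝ⟯) Y, t X (f • Y) = f • t X Y := fun X f Y => by
    apply quadratic_injective
    rw [quadratic_smul, ht, ht, h.smul_right, h₀.smul_right, hA.quadratic_smul_right, hτ,
      momentum_add]
    ring
  refine ⟨LinearMap.mk₂ C^∞⟮𝓡 n, M; ℝ⟯ t (fun X X' Y => ?_) (fun f X Y => ?_) hadd
    (fun f X Y => hsmul X f Y), hskew, fun X Y => ?_⟩
  · rw [hskew Y, hadd, hskew X, hskew X', neg_add, neg_neg, neg_neg]
  · rw [hskew Y, hsmul, hskew X, smul_neg, neg_neg]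
  · rw [LinearMap.mk₂_apply]
    change _ = _ + (Ψ X Y - Ψ₀ X Y - A X Y)
    abel

end Affine

end CotangentLift

theorem proposition2p9 {n : ℕ} {M : Type*} [TopologicalSpace M] [T2Space M]
    [SecondCountableTopology M] [ChartedSpace (EuclideanSpace ℝ (Fin n)) M]
    [IsManifold (𝓡 n) ∞ M]
    (w : CotangentLift.BivectorField (𝓡 n) M) (hw : w.IsPoisson) :
    -- every graded semi-Poisson lift has a unique connection and operator
    (∀ W : CotangentLift.CotangentBivector n M, CotangentLift.IsGradedSemiPoissonLift w W →
      ∃! DΨ : CotangentLift.ContravariantConnection w ×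
          (CotangentLift.VectorField (𝓡 n) M → CotangentLift.VectorField (𝓡 n) M →
            CotangentLift.SymTwo (𝓡 n) M),
        CotangentLift.IsDefinedBy W DΨ.1 DΨ.2) ∧
    -- description of all lifts relative to a fixed one
    (∀ W₀ : CotangentLift.CotangentBivector n M, CotangentLift.IsGradedSemiPoissonLift w W₀ →
      ∀ (D₀ : CotangentLift.ContravariantConnection w)
        (Ψ₀ : CotangentLift.VectorField (𝓡 n) M → CotangentLift.VectorField (𝓡 n) M →
          CotangentLift.SymTwo (𝓡 n) M), CotangentLift.IsDefinedBy W₀ D₀ Ψ₀ →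
        -- for every connection there are a tensor `τ = D - D₀` and an operator `A`
        (∀ D : CotangentLift.ContravariantConnection w,
          ∃ τ : CotangentLift.TensorTwoOne (𝓡 n) M,
            (∀ α X, D.toFun α X = D₀.toFun α X + τ α X) ∧
            ∃ A, CotangentLift.IsSkewOperatorWithSymbol τ A) ∧
        -- every lift is given by `w`, `D` and `Ψ₀ + A + T`
        (∀ (W : CotangentLift.CotangentBivector n M)
          (D : CotangentLift.ContravariantConnection w)
          (Ψ : CotangentLift.VectorField (𝓡 n) M → CotangentLift.VectorField (𝓡 n) M →
            CotangentLift.SymTwo (𝓡 n) M)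
          (τ : CotangentLift.TensorTwoOne (𝓡 n) M)
          (A : CotangentLift.VectorField (𝓡 n) M → CotangentLift.VectorField (𝓡 n) M →
            CotangentLift.SymTwo (𝓡 n) M),
          CotangentLift.IsGradedSemiPoissonLift w W → CotangentLift.IsDefinedBy W D Ψ →
          (∀ α X, D.toFun α X = D₀.toFun α X + τ α X) →
          CotangentLift.IsSkewOperatorWithSymbol τ A →
          ∃! T : CotangentLift.SymTensorTwoTwo (𝓡 n) M,
            (∀ X Y, T Y X = -T X Y) ∧ ∀ X Y, Ψ X Y = Ψ₀ X Y + A X Y + T X Y) ∧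
        -- all such data define a lift, and determine it
        (∀ (D : CotangentLift.ContravariantConnection w)
          (τ : CotangentLift.TensorTwoOne (𝓡 n) M)
          (A : CotangentLift.VectorField (𝓡 n) M → CotangentLift.VectorField (𝓡 n) M →
            CotangentLift.SymTwo (𝓡 n) M)
          (T : CotangentLift.SymTensorTwoTwo (𝓡 n) M),
          (∀ α X, D.toFun α X = D₀.toFun α X + τ α X) →
          CotangentLift.IsSkewOperatorWithSymbol τ A →
          (∀ X Y, T Y X = -T X Y) →
          ∃ W : CotangentLift.CotangentBivector n M,
            CotangentLift.IsGradedSemiPoissonLift w W ∧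
            CotangentLift.IsDefinedBy W D (fun X Y => Ψ₀ X Y + A X Y + T X Y) ∧
            ∀ W' : CotangentLift.CotangentBivector n M,
              CotangentLift.IsDefinedBy W' D (fun X Y => Ψ₀ X Y + A X Y + T X Y) → W' = W)) := by
  refine ⟨fun W hW => ?_, fun W₀ _ D₀ Ψ₀ h₀ => ⟨fun D => ?_, ?_, ?_⟩⟩
  · obtain ⟨D, Ψ, h⟩ := hW.exists_isDefinedBy
    exact ⟨(D, Ψ), h, fun DΨ h' =>
      Prod.ext (h'.connection_unique h) (h'.operator_unique h)⟩
  · obtain ⟨τ, hτ⟩ := D.exists_difference D₀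
    exact ⟨τ, hτ, CotangentLift.exists_isSkewOperatorWithSymbol τ⟩
  · intro W D Ψ τ A _ h hτ hA
    obtain ⟨T, hskew, hT⟩ := h.isBracketOperator.exists_tensor h₀.isBracketOperator hτ hA
    refine ⟨T, ⟨hskew, hT⟩, fun T' hT' => LinearMap.ext fun X => LinearMap.ext fun Y => ?_⟩
    exact add_left_cancel ((hT'.2 X Y).symm.trans (hT X Y))
  · intro D τ A T hτ hA hT
    obtain ⟨W, hW⟩ := (h₀.isBracketOperator.add hτ hA hT).exists_isDefinedBy
    exact ⟨W, hW.isLift hw, hW, fun W' hW' => hW'.unique hW⟩
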